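/- Let $M$ be a closed (compact, without boundary) smooth $7$-manifold with a Sasakian structure $(\theta,g,\Phi)$: $\theta$ is a contact form with Reeb field $\xi$, $g$ is a Riemannian metric and $\Phi$ a section of $\mathrm{End}(TM)$ with $$g(\xi,\xi)=1,\quad \Phi^2=-\mathrm{Id}+\theta\otimes\xi,\quad g(\Phi X,\Phi Y)=g(X,Y)-\theta(X)\theta(Y),$$ $$\nabla_X\xi=-\kappa\,\Phi X,\quad (\nabla_X\Phi)Y=\kappa\,(g(X,Y)\xi-\theta(Y)X),$$ where $\nabla$ is the Levi-Civita connection and $\kappa\in\{1,-1\}$ is a fixed sign (either convention is allowed). Put $B=\ker\theta$, let $B^{1,0}$, $B^{0,1}$ be the $\pm i$-eigenspaces of $\Phi$ on $B\otimes\mathbb C$, and let $\omega=d\theta$. Let $\epsilon$ be a contact Calabi--Yau structure: a smooth, nowhere vanishing, transversal ($\xi\lrcorner\epsilon=0$ and $\mathcal L_X\epsilon=0$ for $X$ tangent to the foliation of $\xi$) complex form of type $(3,0)$ with $d\epsilon=0$ and $\epsilon\wedge\bar\epsilon=c\,\omega^3$ for some constant $c\in\mathbb C$. The natural $\mathrm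 G_2$-structure is given by $\varphi=\theta\wedge\omega+\mathrm{Im}\,\epsilon$ and $\psi=\tfrac12\,\omega\wedge\omega+\theta\wedge\mathrm{Re}\,\epsilon$ (one has $\psi=*\varphi$ for the normalisation $\kappa=-1$, $c=-\tfrac43 i$). A holomorphic Sasakian bundle $\mathcal E$ over $M$ is a smooth complex vector bundle $E\to M$ with a partial connection $D_\xi$ along $\xi_{\mathbb C}$ and a flat partial connection $\bar\partial$ along $B^{0,1}\oplus\xi_{\mathbb C}\subset TM\otimes\mathbb C$ with $\bar\partial|_{\xi_{\mathbb C}}=D_\xi$. A Hermitian structure on $\mathcal E$ is a smooth Hermitian metric $h$ on $E$ preserved by $D_\xi$. A Chern connection on $\mathcal E$ is a connection $A$ on $E$ that, for some Hermitian structure $h$ on $\mathcal E$, is unitary for $h$ and has $d_A|_{B^{0,1}\oplus\xi_{\mathbb C}}=\bar\partial$. A connection $A$ on $E$ with curvature $F_A$ is transversely Hermitian Yang--Mills if the pointwise inner product $\hat F_A:=(F_A,\omega)$ vanishes and $F_A^{0,2}=0$ (i.e. $F_A(Z,W)=0$ for $Z,W\in B^{0,1}$). Then a Chern connection $A$ on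 $\mathcal E$ is transversely Hermitian Yang--Mills if and only if it is a $\mathrm G_2$-instanton, i.e. $F_A\wedge\psi=0$. -/

import Mathlib

open scoped Manifold ContDiff TensorProduct

noncomputable section

namespace SasakiGauge

/-- The model space of `7`-manifolds. -/
abbrev R7 : Type := EuclideanSpace ℝ (Fin 7)

/-! ### Wedge products, pointwise -/

section Wedge

/-- Wedge product at a point of a `k`-form `α` with values in a vector space `W` and a scalar
`l`-form `β`, evaluated on `k + l` vectors:
`(α ∧ β)(v) = 1 / (k! l!) ∑ σ, sgn σ • α(v_σ(1), …, v_σ(k)) β(v_σ(k+1), …, v_σ(k+l))`. -/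
def wedge {T R W : Type*} [Field R] [AddCommGroup W] [Module R W] {k l : ℕ}
    (α : (Fin k → T) → W) (β : (Fin l → T) → R) (v : Fin (k + l) → T) : W :=
  ((k.factorial * l.factorial : ℕ) : R)⁻¹ •
    ∑ σ : Equiv.Perm (Fin (k + l)),
      (((Equiv.Perm.sign σ : ℤ) : R) * β (fun j => v (σ (Fin.natAdd k j)))) •
        α (fun i => v (σ (Fin.castAdd l i)))

/-- The vector `u + i v` in the complexification of a real vector space. -/
def cvec {T : Type*} [AddCommGroup T] [Module ℝ T] (u v : T) : ℂ ⊗[ℝ] T :=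
  (1 : ℂ) ⊗ₜ[ℝ] u + Complex.I ⊗ₜ[ℝ] v

end Wedge

/-! ### Vector fields, sections and differential forms on a `7`-manifold -/

section Manifold

variable (M : Type*) [TopologicalSpace M] [ChartedSpace R7 M]

/-- Differential `k`-forms (not necessarily smooth) on `M` with values in `W`. -/
abbrev Form (k : ℕ) (W : Type*) [NormedAddCommGroup W] [NormedSpace ℝ W] : Type _ :=
  (x : M) → (TangentSpace (𝓡 7) x) [⋀^Fin k]→L[ℝ] W

variable {M}

/-- Smooth vector fields. -/
def SmoothVF [IsManifold (𝓡 7) 1 M] (X : (x : M) → TangentSpace (𝓡 7) x) : Prop :=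
  ContMDiff (𝓡 7) (𝓡 7).tangent ∞ (fun x => (⟨x, X x⟩ : TangentBundle (𝓡 7) M))

/-- Vector fields that are differentiable at a point. -/
def DiffVFAt [IsManifold (𝓡 7) 1 M] (X : (x : M) → TangentSpace (𝓡 7) x) (x : M) : Prop :=
  MDifferentiableAt (𝓡 7) (𝓡 7).tangent (fun y => (⟨y, X y⟩ : TangentBundle (𝓡 7) M)) x

/-- Smooth sections of a vector bundle `V` with model fibre `F`. -/
def SmoothSec (F : Type*) [NormedAddCommGroup F] [NormedSpace ℝ F] {V : M → Type*}
    [TopologicalSpace (Bundle.TotalSpace F V)] [∀ x, TopologicalSpace (V x)] [FiberBundle F V]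
    (s : (x : M) → V x) : Prop :=
  ContMDiff (𝓡 7) ((𝓡 7).prod 𝓘(ℝ, F)) ∞ (fun x => Bundle.TotalSpace.mk' F x (s x))

variable {k : ℕ} {W : Type*} [NormedAddCommGroup W] [NormedSpace ℝ W]

/-- The expression of a form in the preferred chart at `x`, i.e. its pullback to the model space
under the inverse of that chart. -/
def Form.inChart (β : Form M k W) (x : M) (y : R7) : R7 [⋀^Fin k]→L[ℝ] W :=
  (β ((extChartAt (𝓡 7) x).symm y)).compContinuousLinearMap
    (mfderiv 𝓘(ℝ, R7) (𝓡 7) (extChartAt (𝓡 7) x).symm y)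

/-- A form is smooth if all its expressions in charts are. -/
def Form.IsSmooth (β : Form M k W) : Prop :=
  ∀ x : M, ContDiffOn ℝ ∞ (β.inChart x) (extChartAt (𝓡 7) x).target

/-- Exterior derivative: at `x`, differentiate the expression in the preferred chart at `x` and
pull the result back to `M`. -/
def Form.d (β : Form M k W) : Form M (k + 1) W := fun x =>
  (extDeriv (β.inChart x) (extChartAt (𝓡 7) x x)).compContinuousLinearMap
    (mfderiv (𝓡 7) 𝓘(ℝ, R7) (extChartAt (𝓡 7) x) x)

/-- Value of a `1`-form on a vector. -/
def Form.app (θ : Form M 1 W) (x : M) (u : TangentSpace (𝓡 7) x) : W := θ x ![u]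

/-- `ξ ⌟ β = 0`. -/
def Form.IsHorizontal (β : Form M (k + 1) W) (ξ : (x : M) → TangentSpace (𝓡 7) x) : Prop :=
  ∀ (x : M) (v : Fin k → TangentSpace (𝓡 7) x), β x (Matrix.vecCons (ξ x) v) = 0

/-- `D` is the Levi-Civita connection of the Riemannian metric `g`: it is torsion free and
metric. -/
structure IsLeviCivita [IsManifold (𝓡 7) ∞ M]
    (g : Bundle.ContMDiffRiemannianMetric (𝓡 7) ∞ R7
      (fun x : M => TangentSpace (𝓡 7) x))
    (D : CovariantDerivative (𝓡 7) R7 (fun x : M => TangentSpace (𝓡 7) x)) : Prop where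
  torsion_free : ∀ (X Y : (x : M) → TangentSpace (𝓡 7) x) (x : M), DiffVFAt X x → DiffVFAt Y x →
    D Y x (X x) - D X x (Y x) = VectorField.mlieBracket (𝓡 7) X Y x
  metric : ∀ (Y Z : (x : M) → TangentSpace (𝓡 7) x) (x : M) (u : TangentSpace (𝓡 7) x),
    DiffVFAt Y x → DiffVFAt Z x →
    mvfderiv (𝓡 7) (fun y => g.inner y (Y y) (Z y)) x u
      = g.inner x (D Y x u) (Z x) + g.inner x (Y x) (D Z x u)

end Manifold

/-! ### Sasakian and contact Calabi-Yau structures -/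

section Sasakian

/-- A Sasakian structure `(θ, g, Φ)`, with Reeb field `ξ`, on a `7`-manifold `M`.
The sign `κ` fixes the convention for `Φ`: the two usual conventions differ by `Φ ↦ -Φ`, and
`κ = 1` is the one with `∇_X ξ = -Φ X`. -/
structure SasakianStructure (M : Type*) [TopologicalSpace M] [ChartedSpace R7 M]
    [IsManifold (𝓡 7) ∞ M] where
  /-- The sign convention. -/
  κ : ℝ
  κ_eq : κ = 1 ∨ κ = -1
  /-- The contact form. -/
  θ : Form M 1 ℝ
  θ_smooth : θ.IsSmooth
  /-- The contact condition: `θ ∧ (dθ)³` has no zero. -/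
  contact : ∀ x : M, ∃ v : Fin 7 → TangentSpace (𝓡 7) x,
    wedge (θ x) (wedge (wedge (θ.d x) (θ.d x)) (θ.d x)) v ≠ (0 : ℝ)
  /-- The Reeb vector field. -/
  ξ : (x : M) → TangentSpace (𝓡 7) x
  ξ_smooth : SmoothVF ξ
  θ_ξ : ∀ x, θ.app x (ξ x) = 1
  ξ_dθ : θ.d.IsHorizontal ξ
  /-- The Riemannian metric. -/
  g : Bundle.ContMDiffRiemannianMetric (𝓡 7) ∞ R7
    (fun x : M => TangentSpace (𝓡 7) x)
  /-- The section `Φ` of `End(TM)`. -/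
  Φ : (x : M) → TangentSpace (𝓡 7) x →L[ℝ] TangentSpace (𝓡 7) x
  Φ_smooth : ContMDiff (𝓡 7) ((𝓡 7).prod 𝓘(ℝ, R7 →L[ℝ] R7)) ∞
    (fun x => Bundle.TotalSpace.mk' (R7 →L[ℝ] R7)
      (E := fun x : M => TangentSpace (𝓡 7) x →L[ℝ] TangentSpace (𝓡 7) x) x (Φ x))
  g_ξ : ∀ x, g.inner x (ξ x) (ξ x) = 1
  Φ_sq : ∀ x (u : TangentSpace (𝓡 7) x), Φ x (Φ x u) = -u + θ.app x u • ξ x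
  g_Φ : ∀ x (u v : TangentSpace (𝓡 7) x),
    g.inner x (Φ x u) (Φ x v) = g.inner x u v - θ.app x u * θ.app x v
  /-- `∇_X ξ = -κ Φ X` and `(∇_X Φ) Y = κ (g(X, Y) ξ - θ(Y) X)` for the Levi-Civita
  connection `∇` of `g`. -/
  levi_civita : ∃ D : CovariantDerivative (𝓡 7) R7 (fun x : M => TangentSpace (𝓡 7) x),
    IsLeviCivita g D ∧
    (∀ x (u : TangentSpace (𝓡 7) x), D ξ x u = -(κ • Φ x u)) ∧
    (∀ (Y : (x : M) → TangentSpace (𝓡 7) x) (x : M) (u : TangentSpace (𝓡 7) x), DiffVFAt Y x →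
      D (fun y => Φ y (Y y)) x u - Φ x (D Y x u)
        = κ • (g.inner x u (Y x) • ξ x - θ.app x (Y x) • u))

variable {M : Type*} [TopologicalSpace M] [ChartedSpace R7 M] [IsManifold (𝓡 7) ∞ M]

namespace SasakianStructure

variable (S : SasakianStructure M)

/-- The transverse Kähler form `ω = dθ`. -/
def om : Form M 2 ℝ := S.θ.d

/-- The contact distribution `B = ker θ`. -/
def B (x : M) : Submodule ℝ (TangentSpace (𝓡 7) x) where
  carrier := {u | S.θ.app x u = 0}
  add_mem' {u v} hu hv := by
    have h := (S.θ x).map_update_add ![0] 0 u v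
    have e : ∀ w : TangentSpace (𝓡 7) x, Function.update ![0] 0 w = ![w] := fun w => by
      ext i; fin_cases i; simp
    simp only [e] at h
    simp only [Form.app, Set.mem_ofPred_eq] at *
    rw [h, hu, hv, add_zero]
  zero_mem' := (S.θ x).map_coord_zero 0 rfl
  smul_mem' c u hu := by
    have h := (S.θ x).map_update_smul ![0] 0 c u
    have e : ∀ w : TangentSpace (𝓡 7) x, Function.update ![0] 0 w = ![w] := fun w => by
      ext i; fin_cases i; simp
    simp only [e] at h
    simp only [Form.app, Set.mem_ofPred_eq] at *
    rw [h, hu, smul_zero]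

/-- `B^{0,1}`: the eigenspace of `Φ` in `B ⊗ ℂ` for the eigenvalue `-i`. -/
def B01 (x : M) : Submodule ℂ (ℂ ⊗[ℝ] TangentSpace (𝓡 7) x) :=
  (S.B x).baseChange ℂ ⊓
    LinearMap.ker (LinearMap.baseChange ℂ (S.Φ x : TangentSpace (𝓡 7) x →ₗ[ℝ] _) +
      Complex.I • LinearMap.id)

/-- The complex line spanned by the Reeb field. -/
def ξC (x : M) : Submodule ℂ (ℂ ⊗[ℝ] TangentSpace (𝓡 7) x) :=
  Submodule.span ℂ {(1 : ℂ) ⊗ₜ[ℝ] S.ξ x}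

/-- The extended anti-holomorphic distribution `B^{0,1} ⊕ ξ_ℂ`. -/
def B01ext (x : M) : Submodule ℂ (ℂ ⊗[ℝ] TangentSpace (𝓡 7) x) := S.B01 x ⊔ S.ξC x

end SasakianStructure

/-- A contact Calabi-Yau structure with underlying Sasakian structure `S`: a nowhere vanishing
closed transversal form `ε` of type `(3, 0)` with `ε ∧ ε̄ = c ω³`; any constant `c` is allowed.
Transversality is `ξ ⌟ ε = 0` together with invariance along the characteristic foliation, which
by Cartan's formula is part of `ξ ⌟ ε = 0` and `dε = 0`. -/
structure ContactCalabiYau (S : SasakianStructure M) where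
  /-- The transverse complex volume form. -/
  ε : Form M 3 ℂ
  smooth : ε.IsSmooth
  ne_zero : ∀ x, ε x ≠ 0
  horizontal : ε.IsHorizontal S.ξ
  type_30 : ∀ (x : M) (u v a b : TangentSpace (𝓡 7) x), cvec u v ∈ S.B01 x →
    ε x ![u, a, b] + Complex.I * ε x ![v, a, b] = 0
  closed : ∀ x, ε.d x = 0
  /-- The normalisation constant. -/
  c : ℂ
  volume : ∀ (x : M) (v : Fin 6 → TangentSpace (𝓡 7) x),
    wedge (ε x) (fun w => starRingEnd ℂ (ε x w)) v
      = c * ((wedge (wedge (S.om x) (S.om x)) (S.om x) v : ℝ) : ℂ)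

/-- The `4`-form `ψ = ½ ω ∧ ω + θ ∧ Re ε` of the natural `G₂`-structure. -/
def ContactCalabiYau.ψ {S : SasakianStructure M} (C : ContactCalabiYau S) (x : M)
    (v : Fin 4 → TangentSpace (𝓡 7) x) : ℝ :=
  1 / 2 * wedge (S.om x) (S.om x) v + wedge (k := 1) (l := 3) (S.θ x) (fun w => (C.ε x w).re) v

end Sasakian

/-! ### Holomorphic Sasakian bundles -/

section Bundles

variable {M : Type*} [TopologicalSpace M] [ChartedSpace R7 M] [IsManifold (𝓡 7) ∞ M]
variable (F : Type*) [NormedAddCommGroup F] [NormedSpace ℂ F]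
variable (V : M → Type*) [TopologicalSpace (Bundle.TotalSpace F V)]
  [∀ x, AddCommGroup (V x)] [∀ x, Module ℂ (V x)] [∀ x, TopologicalSpace (V x)]
  [∀ x, IsTopologicalAddGroup (V x)] [∀ x, ContinuousSMul ℝ (V x)]
  [FiberBundle F V]

/-- A partial connection on the complex vector bundle `V` along a subbundle `L ⊆ TM ⊗ ℂ`: a
smooth differential operator from sections of `V` to sections of `L* ⊗ V` with the Leibniz
rule. -/
structure PartialConnection (L : (x : M) → Submodule ℂ (ℂ ⊗[ℝ] TangentSpace (𝓡 7) x)) where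
  /-- The operator. -/
  toFun : ((x : M) → V x) → (x : M) → (L x →ₗ[ℂ] V x)
  add : ∀ s t : (x : M) → V x, SmoothSec F s → SmoothSec F t → ∀ x,
    toFun (fun y => s y + t y) x = toFun s x + toFun t x
  leibniz : ∀ (f : M → ℂ) (s : (x : M) → V x), ContMDiff (𝓡 7) 𝓘(ℝ, ℂ) ∞ f → SmoothSec F s →
    ∀ (x : M) (Z : L x), toFun (fun y => f y • s y) x Z
      = f x • toFun s x Z
        + LinearMap.liftBaseChange ℂ (mvfderiv (𝓡 7) f x : TangentSpace (𝓡 7) x →ₗ[ℝ] ℂ) Z.1 • s x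
  smooth : ∀ (s : (x : M) → V x) (X Y : (x : M) → TangentSpace (𝓡 7) x), SmoothSec F s →
    SmoothVF X → SmoothVF Y → ∀ hL : ∀ x, cvec (X x) (Y x) ∈ L x,
    SmoothSec F (fun x => toFun s x ⟨cvec (X x) (Y x), hL x⟩)

variable {F V}

/-- Flatness of a partial connection: `D_Z D_W s - D_W D_Z s - D_[Z, W] s = 0` for smooth sections
`Z = X + i Y`, `W = X' + i Y'` of `L`, where `[Z, W]` is
`([X, X'] - [Y, Y']) + i ([X, Y'] + [Y, X'])`. -/
def PartialConnection.IsFlat {L : (x : M) → Submodule ℂ (ℂ ⊗[ℝ] TangentSpace (𝓡 7) x)}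
    (D : PartialConnection F V L) : Prop :=
  ∀ X Y X' Y' : (x : M) → TangentSpace (𝓡 7) x,
    SmoothVF X → SmoothVF Y → SmoothVF X' → SmoothVF Y' →
    ∀ (hZ : ∀ x, cvec (X x) (Y x) ∈ L x) (hW : ∀ x, cvec (X' x) (Y' x) ∈ L x)
      (hb : ∀ x, cvec
        (VectorField.mlieBracket (𝓡 7) X X' x - VectorField.mlieBracket (𝓡 7) Y Y' x)
        (VectorField.mlieBracket (𝓡 7) X Y' x + VectorField.mlieBracket (𝓡 7) Y X' x) ∈ L x)
      (s : (x : M) → V x), SmoothSec F s → ∀ x,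
      D.toFun (fun y => D.toFun s y ⟨_, hW y⟩) x ⟨_, hZ x⟩
        - D.toFun (fun y => D.toFun s y ⟨_, hZ y⟩) x ⟨_, hW x⟩
        - D.toFun s x ⟨_, hb x⟩ = 0

variable (F V)

/-- A Sasakian bundle structure on `V` (a partial connection along the Reeb direction) together
with a holomorphic structure: a flat partial connection along `B^{0,1} ⊕ ξ_ℂ` that restricts to
the given one along `ξ_ℂ`. -/
structure HolomorphicSasakianBundle (S : SasakianStructure M) where
  /-- The partial connection along the Reeb direction. -/
  Dξ : PartialConnection F V S.ξC
  /-- The holomorphic structure. -/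
  dbar : PartialConnection F V S.B01ext
  flat : dbar.IsFlat
  compat : ∀ s : (x : M) → V x, SmoothSec F s → ∀ (x : M) (Z : S.ξC x),
    dbar.toFun s x ⟨Z.1, (le_sup_right : S.ξC x ≤ S.B01ext x) Z.2⟩ = Dξ.toFun s x Z

variable {F V}

/-- The Reeb vector as an element of the line it spans. -/
def reeb (S : SasakianStructure M) (x : M) : S.ξC x :=
  ⟨(1 : ℂ) ⊗ₜ[ℝ] S.ξ x, Submodule.mem_span_singleton_self _⟩

/-- A Hermitian structure on a holomorphic Sasakian bundle: a smooth Hermitian metric (conjugate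
linear in the first argument) preserved by the partial connection along `ξ`. -/
structure HermitianStructure {S : SasakianStructure M}
    (Eh : HolomorphicSasakianBundle F V S) where
  /-- The Hermitian form on the fibres. -/
  h : (x : M) → V x →ₗ⋆[ℂ] V x →ₗ[ℂ] ℂ
  symm : ∀ (x : M) (s t : V x), starRingEnd ℂ (h x s t) = h x t s
  pos : ∀ (x : M) (s : V x), s ≠ 0 → 0 < (h x s s).re
  smooth : ∀ s t : (x : M) → V x, SmoothSec F s → SmoothSec F t →
    ContMDiff (𝓡 7) 𝓘(ℝ, ℂ) ∞ (fun x => h x (s x) (t x))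
  preserved : ∀ s t : (x : M) → V x, SmoothSec F s → SmoothSec F t → ∀ x,
    mvfderiv (𝓡 7) (fun y => h y (s y) (t y)) x (S.ξ x)
      = h x (Eh.Dξ.toFun s x (reeb S x)) (t x) + h x (s x) (Eh.Dξ.toFun t x (reeb S x))

/-- `A` is a Chern connection of `(Eh, H)`: a smooth complex connection that is unitary for the
Hermitian structure and induces the holomorphic structure along `B^{0,1} ⊕ ξ_ℂ`. -/
structure IsChernConnection [VectorBundle ℝ F V] {S : SasakianStructure M}
    {Eh : HolomorphicSasakianBundle F V S}
    (H : HermitianStructure Eh) (A : CovariantDerivative (𝓡 7) F V) : Prop where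
  smooth : ContMDiffCovariantDerivativeOn F ∞ A.toFun Set.univ
  complex : ∀ s : (x : M) → V x, SmoothSec F s → ∀ (x : M) (u : TangentSpace (𝓡 7) x),
    A (fun y => Complex.I • s y) x u = Complex.I • A s x u
  unitary : ∀ s t : (x : M) → V x, SmoothSec F s → SmoothSec F t →
    ∀ (x : M) (u : TangentSpace (𝓡 7) x),
    mvfderiv (𝓡 7) (fun y => H.h y (s y) (t y)) x u
      = H.h x (A s x u) (t x) + H.h x (s x) (A t x u)
  integrable : ∀ s : (x : M) → V x, SmoothSec F s → ∀ (x : M) (Z : S.B01ext x),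
    LinearMap.liftBaseChange ℂ (A s x : TangentSpace (𝓡 7) x →ₗ[ℝ] V x) Z.1 = Eh.dbar.toFun s x Z

/-- The curvature `F_A(u, v) s = ∇_X ∇_Y σ - ∇_Y ∇_X σ - ∇_[X, Y] σ` at `x`, computed with local
smooth extensions `X`, `Y`, `σ` of `u`, `v`, `s`. -/
def curvature (A : CovariantDerivative (𝓡 7) F V) (x : M) (u v : TangentSpace (𝓡 7) x)
    (s : V x) : V x :=
  let X : (y : M) → TangentSpace (𝓡 7) y := FiberBundle.extend R7 u
  let Y : (y : M) → TangentSpace (𝓡 7) y := FiberBundle.extend R7 v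
  let σ : (y : M) → V y := FiberBundle.extend F s
  A (fun y => A σ y (Y y)) x u - A (fun y => A σ y (X y)) x v
    - A σ x (VectorField.mlieBracket (𝓡 7) X Y x)

/-- The transverse Hermitian Yang-Mills condition: `(F_A, ω) = 0`, where the pointwise inner product
of `2`-forms is `∑_{i < j} F_A(e_i, e_j) ω(e_i, e_j)` in orthonormal frames, and the `(0, 2)`
component of `F_A` vanishes. -/
structure IsHYM (S : SasakianStructure M) (A : CovariantDerivative (𝓡 7) F V) : Prop where
  contraction : ∀ (x : M) (s : V x) (e : Fin 7 → TangentSpace (𝓡 7) x),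
    (∀ i j, S.g.inner x (e i) (e j) = if i = j then 1 else 0) →
    ∑ i, ∑ j ∈ Finset.Ioi i, S.om x ![e i, e j] • curvature A x (e i) (e j) s = 0
  type_02 : ∀ (x : M) (s : V x) (u v u' v' : TangentSpace (𝓡 7) x),
    cvec u v ∈ S.B01 x → cvec u' v' ∈ S.B01 x →
    curvature A x u u' s - curvature A x v v' s
      + Complex.I • (curvature A x u v' s + curvature A x v u' s) = 0

/-- The `G₂`-instanton equation `F_A ∧ ψ = 0` for a field of `4`-forms `ψ`. -/
def IsG2Instanton (ψ : (x : M) → (Fin 4 → TangentSpace (𝓡 7) x) → ℝ)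
    (A : CovariantDerivative (𝓡 7) F V) : Prop :=
  ∀ (x : M) (s : V x) (v : Fin 6 → TangentSpace (𝓡 7) x),
    wedge (fun w : Fin 2 → TangentSpace (𝓡 7) x => curvature A x (w 0) (w 1) s) (ψ x) v = 0

end Bundles

end SasakiGauge

end

noncomputable section

namespace SasakiGauge

open Filter Topology

/-! ### Vector fields in charts -/

section Calculus

variable {M : Type*} [TopologicalSpace M] [ChartedSpace R7 M] [IsManifold (𝓡 7) ∞ M]
variable {W : Type*} [NormedAddCommGroup W] [NormedSpace ℝ W]

/-! For a Chern connection the curvature `F` is automatically horizontal and of type `(1, 1)`, so in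
both directions only the condition `(F, ω) = 0` is at stake. Flatness of `∂̄`, evaluated on sections
of `B^{0,1} ⊕ ξ_ℂ`, says that the complex bilinear extension of `F` vanishes there
(`curvatureHom_flat`). This needs the distribution to be involutive, which follows from the formula
for `∇Φ` (`cvec_mlieBracket_mem`, `cvec_mlieBracket_reeb_mem`). Unitarity makes each `F(u, v)`
skew-Hermitian (`curvatureHom_skew`). A relation `a + i b = 0` between skew-Hermitian operators
forces `a = 0` (`eq_zero_of_skew`), which upgrades the complex equations to `F(ξ, ·) = 0` and `F(Φu,
Φv) = F(u, v)` (`exists_curvature_tensor`).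

The rest is linear algebra at a point (`contraction_eq_zero_iff`), where `ω = -2κ g(Φ·, ·)` by
`om_apply`. In `F ∧ ψ = ½ F ∧ ω² + F ∧ θ ∧ Re ε` the second term vanishes: on the transverse space,
of complex dimension 3, `F ∧ ε` would have type `(4, 1)`. The first term is a nonzero multiple of
`(F, ω) ω³`, because in an adapted frame `ξ, a, Φa, b, Φb, c, Φc` both `F ∧ ω²` and `(F, ω)` reduce
to `F(a, Φa) + F(b, Φb) + F(c, Φc)`.

The structures on the bundle act on global smooth sections, while curvature is defined by local
extensions. Cut-off extensions with a prescribed germ, and tensoriality in the vector arguments,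
connect the two. -/

lemma two_le_infty : (2 : WithTop ℕ∞) ≤ ∞ :=
  WithTop.coe_le_coe.2 (le_top : (2 : ℕ∞) ≤ ⊤)

lemma mdifferentiableAt_extChartAt_symm {x : M} {y : R7} (hy : y ∈ (extChartAt (𝓡 7) x).target) :
    MDifferentiableAt 𝓘(ℝ, R7) (𝓡 7) (extChartAt (𝓡 7) x).symm y :=
  ((contMDiffOn_extChartAt_symm (n := 1) x).contMDiffAt
    ((isOpen_extChartAt_target x).mem_nhds hy)).mdifferentiableAt one_ne_zero

lemma fderiv_comp_extChartAt_symm {f : M → W} {x : M} {y : R7}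
    (hy : y ∈ (extChartAt (𝓡 7) x).target)
    (hf : MDifferentiableAt (𝓡 7) 𝓘(ℝ, W) f ((extChartAt (𝓡 7) x).symm y)) (w : R7) :
    fderiv ℝ (f ∘ (extChartAt (𝓡 7) x).symm) y w =
      mvfderiv (𝓡 7) f ((extChartAt (𝓡 7) x).symm y)
        (mfderiv 𝓘(ℝ, R7) (𝓡 7) (extChartAt (𝓡 7) x).symm y w) := by
  have h := mfderiv_comp y hf (mdifferentiableAt_extChartAt_symm hy)
  rw [mfderiv_eq_fderiv] at h
  exact congrArg (fun L : R7 →L[ℝ] W => L w) h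

lemma mfderiv_extChartAt_symm_self (x : M) :
    mfderiv 𝓘(ℝ, R7) (𝓡 7) (extChartAt (𝓡 7) x).symm (extChartAt (𝓡 7) x x) =
      ContinuousLinearMap.id ℝ R7 := by
  have h := mfderivWithin_range_extChartAt_symm (I := 𝓡 7) (x := x)
  rw [ModelWithCorners.range_eq_univ, mfderivWithin_univ] at h
  exact h

lemma fderiv_comp_extChartAt_symm_self {f : M → W} {x : M}
    (hf : MDifferentiableAt (𝓡 7) 𝓘(ℝ, W) f x) (w : TangentSpace (𝓡 7) x) :
    fderiv ℝ (f ∘ (extChartAt (𝓡 7) x).symm) (extChartAt (𝓡 7) x x) w = mvfderiv (𝓡 7) f x w := by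
  have hf' : MDifferentiableAt (𝓡 7) 𝓘(ℝ, W) f
      ((extChartAt (𝓡 7) x).symm (extChartAt (𝓡 7) x x)) := by
    rwa [extChartAt_to_inv]
  have h := mfderiv_comp (extChartAt (𝓡 7) x x) hf'
    (mdifferentiableAt_extChartAt_symm (mem_extChartAt_target x))
  rw [mfderiv_eq_fderiv, mfderiv_extChartAt_symm_self] at h
  have h2 := congrArg (fun L : R7 →L[ℝ] W => L w) h
  refine h2.trans ?_
  change mvfderiv (𝓡 7) f ((extChartAt (𝓡 7) x).symm (extChartAt (𝓡 7) x x)) w = _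
  -- Both tangent spaces are the model space, so equality of base points can be transported through
  -- the derivative.
  have : ∀ z : M, z = x → (mvfderiv (𝓡 7) f z : R7 →L[ℝ] W) = mvfderiv (𝓡 7) f x := by
    rintro z rfl; rfl
  exact congrArg (fun L : R7 →L[ℝ] W => L w) (this _ (extChartAt_to_inv x))

/-- The expression of a vector field in the preferred chart at `x`. -/
def chartVF (x : M) (X : (y : M) → TangentSpace (𝓡 7) y) (y : R7) : R7 :=
  VectorField.mpullback 𝓘(ℝ, R7) (𝓡 7) (extChartAt (𝓡 7) x).symm X y

lemma mfderiv_symm_chartVF {x : M} (X : (y : M) → TangentSpace (𝓡 7) y) {y : R7}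
    (hy : y ∈ (extChartAt (𝓡 7) x).target) :
    mfderiv 𝓘(ℝ, R7) (𝓡 7) (extChartAt (𝓡 7) x).symm y (chartVF x X y) =
      X ((extChartAt (𝓡 7) x).symm y) := by
  have h := isInvertible_mfderivWithin_extChartAt_symm (I := 𝓡 7) hy
  rw [ModelWithCorners.range_eq_univ, mfderivWithin_univ] at h
  rw [chartVF, VectorField.mpullback_apply]
  exact h.self_apply_inverse _

lemma chartVF_self (x : M) (X : (y : M) → TangentSpace (𝓡 7) y) :
    chartVF x X (extChartAt (𝓡 7) x x) = X x := by
  have h := mfderiv_symm_chartVF X (mem_extChartAt_target (I := 𝓡 7) x)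
  rw [mfderiv_extChartAt_symm_self] at h
  have : ∀ z : M, z = x → (X z : R7) = X x := by
    rintro z rfl; rfl
  exact h.trans (this _ (extChartAt_to_inv x))

lemma differentiableAt_chartVF {x : M} {X : (y : M) → TangentSpace (𝓡 7) y}
    (hX : DiffVFAt X x) : DifferentiableAt ℝ (chartVF x X) (extChartAt (𝓡 7) x x) := by
  have : IsManifold (𝓡 7) 2 M := IsManifold.of_le (n := ∞) two_le_infty
  have h := MDifferentiableWithinAt.differentiableWithinAt_mpullbackWithin_vectorField
    (I := 𝓡 7) (s := Set.univ) (x := x) (V := X) (mdifferentiableWithinAt_univ.2 hX)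
  rw [ModelWithCorners.range_eq_univ, Set.preimage_univ, Set.univ_inter,
    VectorField.mpullbackWithin_univ] at h
  exact differentiableWithinAt_univ.1 h

lemma mlieBracket_eq_lieBracket_chartVF (X Y : (y : M) → TangentSpace (𝓡 7) y) (x : M) :
    VectorField.mlieBracket (𝓡 7) X Y x =
      VectorField.lieBracket ℝ (chartVF x X) (chartVF x Y) (extChartAt (𝓡 7) x x) := by
  rw [← VectorField.mlieBracketWithin_univ, VectorField.mlieBracketWithin_apply,
    mfderiv_extChartAt_self, ModelWithCorners.range_eq_univ,
    Set.preimage_univ, Set.univ_inter, VectorField.mpullbackWithin_univ,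
    VectorField.mpullbackWithin_univ]
  refine (congrArg (fun L : R7 →L[ℝ] R7 => L (VectorField.lieBracketWithin ℝ (chartVF x X)
    (chartVF x Y) Set.univ (extChartAt (𝓡 7) x x)))
    (ContinuousLinearMap.inverse_id (R := ℝ) (M := R7))).trans ?_
  rw [VectorField.lieBracketWithin_univ]
  rfl

/-- Vector fields act on functions as derivations with commutator the Lie bracket. -/
theorem mvfderiv_mlieBracket {f : M → W} (hf : ContMDiff (𝓡 7) 𝓘(ℝ, W) ∞ f)
    {X Y : (y : M) → TangentSpace (𝓡 7) y} {x : M} (hX : DiffVFAt X x) (hY : DiffVFAt Y x)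
    (hYf : MDifferentiableAt (𝓡 7) 𝓘(ℝ, W) (fun y => mvfderiv (𝓡 7) f y (Y y)) x)
    (hXf : MDifferentiableAt (𝓡 7) 𝓘(ℝ, W) (fun y => mvfderiv (𝓡 7) f y (X y)) x) :
    mvfderiv (𝓡 7) f x (VectorField.mlieBracket (𝓡 7) X Y x) =
      mvfderiv (𝓡 7) (fun y => mvfderiv (𝓡 7) f y (Y y)) x (X x) -
        mvfderiv (𝓡 7) (fun y => mvfderiv (𝓡 7) f y (X y)) x (Y x) := by
  have hfd : ∀ y, MDifferentiableAt (𝓡 7) 𝓘(ℝ, W) f y :=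
    fun y => (hf y).mdifferentiableAt (by simp)
  have hg : ContDiffAt ℝ 2 (f ∘ (extChartAt (𝓡 7) x).symm) (extChartAt (𝓡 7) x x) := by
    have h1 : ContMDiffAt 𝓘(ℝ, R7) (𝓡 7) 2 (extChartAt (𝓡 7) x).symm (extChartAt (𝓡 7) x x) :=
      ((contMDiffOn_extChartAt_symm (n := ∞) x).contMDiffAt
        (extChartAt_target_mem_nhds x)).of_le two_le_infty
    exact (((hf.of_le two_le_infty).contMDiffAt).comp _ h1).contDiffAt
  have key : ∀ Z : (y : M) → TangentSpace (𝓡 7) y,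
      (fun y => fderiv ℝ (f ∘ (extChartAt (𝓡 7) x).symm) y (chartVF x Z y)) =ᶠ[
        𝓝 (extChartAt (𝓡 7) x x)]
      (fun y => mvfderiv (𝓡 7) f y (Z y)) ∘ (extChartAt (𝓡 7) x).symm := fun Z => by
    filter_upwards [extChartAt_target_mem_nhds (I := 𝓡 7) x] with y hy
    rw [fderiv_comp_extChartAt_symm hy (hfd _), mfderiv_symm_chartVF Z hy]
    rfl
  -- In the chart the Hessian terms cancel by symmetry of the second derivative, which is why `C²`
  -- regularity was extracted; `key` then turns chart derivatives back into derivatives on `M`.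
  rw [← fderiv_comp_extChartAt_symm_self (hfd x), mlieBracket_eq_lieBracket_chartVF,
    VectorField.fderiv_apply_lieBracket hg (by simp)
      (differentiableAt_chartVF hY) (differentiableAt_chartVF hX),
    (key Y).fderiv_eq, (key X).fderiv_eq, chartVF_self, chartVF_self,
    fderiv_comp_extChartAt_symm_self hYf, fderiv_comp_extChartAt_symm_self hXf]

/-- The trivialization of the tangent bundle at `x` comes from the preferred chart and is the
identity over `x`, so `FiberBundle.extend` produces the coordinate-constant field. Hence brackets of
such extensions vanish at `x`, and the formula for `dθ` on them has no bracket term. -/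
lemma extend_extChartAt_symm {x : M} (u : TangentSpace (𝓡 7) x) {y : R7}
    (hy : y ∈ (extChartAt (𝓡 7) x).target) :
    (FiberBundle.extend R7 u ((extChartAt (𝓡 7) x).symm y) :
      TangentSpace (𝓡 7) ((extChartAt (𝓡 7) x).symm y)) =
      mfderiv 𝓘(ℝ, R7) (𝓡 7) (extChartAt (𝓡 7) x).symm y u := by
  have hs : (extChartAt (𝓡 7) x).symm y ∈ (chartAt R7 x).source := by
    rw [← extChartAt_source (𝓡 7)]
    exact (extChartAt (𝓡 7) x).map_target hy
  have h := TangentBundle.symmL_trivializationAt (I := 𝓡 7) hs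
  rw [ModelWithCorners.range_eq_univ, mfderivWithin_univ, (extChartAt (𝓡 7) x).right_inv hy] at h
  have h1 := TangentBundle.continuousLinearMapAt_trivializationAt (I := 𝓡 7)
    (mem_chart_source R7 x)
  rw [mfderiv_extChartAt_self] at h1
  have h2 : (trivializationAt R7 (TangentSpace (𝓡 7)) x ⟨x, u⟩).2 = u := by
    have h3 := congrArg (fun L : R7 →L[ℝ] R7 => L u) h1
    refine Eq.trans ?_ h3
    change _ = Bundle.Trivialization.continuousLinearMapAt ℝ
      (trivializationAt R7 (TangentSpace (𝓡 7)) x) x u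
    rw [Bundle.Trivialization.continuousLinearMapAt_apply,
      Bundle.Trivialization.linearMapAt_apply,
      if_pos (FiberBundle.mem_baseSet_trivializationAt' x)]
  rw [FiberBundle.extend, h2, ← h]
  exact (Bundle.Trivialization.symmL_apply (R := ℝ) (trivializationAt R7 (TangentSpace (𝓡 7)) x)
    (by simpa using hs) (u : R7)).symm

lemma chartVF_extend {x : M} (u : TangentSpace (𝓡 7) x) {y : R7}
    (hy : y ∈ (extChartAt (𝓡 7) x).target) :
    chartVF x (FiberBundle.extend R7 u) y = u := by
  have h := isInvertible_mfderivWithin_extChartAt_symm (I := 𝓡 7) hy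
  rw [ModelWithCorners.range_eq_univ, mfderivWithin_univ] at h
  rw [chartVF, VectorField.mpullback_apply, extend_extChartAt_symm u hy]
  exact h.inverse_apply_self _

lemma mlieBracket_extend {x : M} (u v : TangentSpace (𝓡 7) x) :
    VectorField.mlieBracket (𝓡 7) (FiberBundle.extend R7 u) (FiberBundle.extend R7 v) x = 0 := by
  rw [mlieBracket_eq_lieBracket_chartVF]
  have h : ∀ w : TangentSpace (𝓡 7) x, chartVF x (FiberBundle.extend R7 w) =ᶠ[
      𝓝 (extChartAt (𝓡 7) x x)] fun _ => w := fun w => by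
    filter_upwards [extChartAt_target_mem_nhds (I := 𝓡 7) x] with y hy using chartVF_extend w hy
  rw [(h u).lieBracket_vectorField_eq (h v)]
  change fderiv ℝ (fun _ : R7 => (v : R7)) _ _ - fderiv ℝ (fun _ : R7 => (u : R7)) _ _ = 0
  simp only [fderiv_fun_const]
  exact sub_self (0 : R7)

lemma extDeriv_one_form_apply {β : R7 → R7 [⋀^Fin 1]→L[ℝ] ℝ} {y : R7}
    (hβ : DifferentiableAt ℝ β y) (u v : R7) :
    extDeriv β y ![u, v] =
      fderiv ℝ (fun z => β z ![v]) y u - fderiv ℝ (fun z => β z ![u]) y v := by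
  have e0 : (0 : Fin 2).removeNth ![u, v] = ![v] := by
    ext i : 1; fin_cases i; rfl
  have e1 : (1 : Fin 2).removeNth ![u, v] = ![u] := by
    ext i : 1; fin_cases i; rfl
  rw [extDeriv_apply hβ, Fin.sum_univ_two, e0, e1]
  simp [sub_eq_add_neg]

/-- The exterior derivative of a smooth `1`-form, on vectors extended to fields that are constant
in a chart. -/
theorem Form.d_apply_extend {β : Form M 1 ℝ} (hβ : β.IsSmooth) {x : M}
    (u v : TangentSpace (𝓡 7) x) :
    β.d x ![u, v] =
      mvfderiv (𝓡 7) (fun y => β.app y (FiberBundle.extend R7 v y)) x u -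
        mvfderiv (𝓡 7) (fun y => β.app y (FiberBundle.extend R7 u y)) x v := by
  have hd : DifferentiableAt ℝ (β.inChart x) (extChartAt (𝓡 7) x x) :=
    ((hβ x).contDiffAt (extChartAt_target_mem_nhds x)).differentiableAt (by simp)
  have key : ∀ w : TangentSpace (𝓡 7) x, (fun y => β.inChart x y ![(w : R7)]) =ᶠ[
      𝓝 (extChartAt (𝓡 7) x x)]
      (fun y => β.app y (FiberBundle.extend R7 w y)) ∘ (extChartAt (𝓡 7) x).symm := fun w => by
    filter_upwards [extChartAt_target_mem_nhds (I := 𝓡 7) x] with y hy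
    simp only [Function.comp_apply]
    rw [extend_extChartAt_symm w hy]
    refine congrArg (β ((extChartAt (𝓡 7) x).symm y)) ?_
    ext i : 1
    fin_cases i
    rfl
  have hdw : ∀ w : TangentSpace (𝓡 7) x,
      DifferentiableAt ℝ (fun y => β.inChart x y ![(w : R7)]) (extChartAt (𝓡 7) x x) := fun w =>
    ((ContinuousAlternatingMap.apply ℝ R7 ℝ ![(w : R7)]).differentiableAt).comp _ hd
  have hm : ∀ w : TangentSpace (𝓡 7) x, MDifferentiableAt (𝓡 7) 𝓘(ℝ, ℝ)
      (fun y => β.app y (FiberBundle.extend R7 w y)) x := fun w => by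
    have h1 := ((hdw w).mdifferentiableAt).comp x
      (mdifferentiableAt_extChartAt (I := 𝓡 7) (mem_chart_source R7 x))
    refine h1.congr_of_eventuallyEq ?_
    have h2 := (continuousAt_extChartAt (I := 𝓡 7) x).eventually (key w)
    filter_upwards [h2, extChartAt_source_mem_nhds (I := 𝓡 7) x] with y hy hs
    refine Eq.trans ?_ hy.symm
    simp only [Function.comp_apply]
    rw [(extChartAt (𝓡 7) x).left_inv hs]
  have hfd : ∀ a w : TangentSpace (𝓡 7) x,
      fderiv ℝ (fun y => β.inChart x y ![(w : R7)]) (extChartAt (𝓡 7) x x) (a : R7) =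
        mvfderiv (𝓡 7) (fun y => β.app y (FiberBundle.extend R7 w y)) x a := fun a w => by
    rw [← fderiv_comp_extChartAt_symm_self (hm w), ← (key w).fderiv_eq]
  rw [← hfd, ← hfd]
  have hid : (mfderiv (𝓡 7) 𝓘(ℝ, R7) (extChartAt (𝓡 7) x) x : R7 →L[ℝ] R7) =
    ContinuousLinearMap.id ℝ R7 := mfderiv_extChartAt_self
  have h1 : β.d x ![u, v] =
      extDeriv (β.inChart x) (extChartAt (𝓡 7) x x) ![(u : R7), (v : R7)] := by
    refine congrArg (extDeriv (β.inChart x) (extChartAt (𝓡 7) x x)) ?_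
    funext i
    exact (congrArg (fun L : R7 →L[ℝ] R7 => L (![(u : R7), (v : R7)] i)) hid)
  exact h1.trans (extDeriv_one_form_apply hd u v)

end Calculus

/-! ### Global sections with prescribed germ -/

section Extension

variable {M : Type*} [TopologicalSpace M] [ChartedSpace R7 M]
variable {F : Type*} [NormedAddCommGroup F] [NormedSpace ℝ F]
variable {V : M → Type*} [TopologicalSpace (Bundle.TotalSpace F V)]
  [∀ x, TopologicalSpace (V x)] [FiberBundle F V]

lemma SmoothSec.mdifferentiableAt {σ : (y : M) → V y} (hσ : SmoothSec F σ) (x : M) :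
    MDifferentiableAt (𝓡 7) ((𝓡 7).prod 𝓘(ℝ, F)) (fun y => Bundle.TotalSpace.mk' F y (σ y)) x :=
  (hσ x).mdifferentiableAt (by simp)

variable [∀ x, AddCommGroup (V x)] [∀ x, Module ℝ (V x)]

/-- Multiply the local extension by a bump function. Agreement of germs, not just of values, is
needed because curvature differentiates the section twice. -/
theorem exists_smoothSec_eventuallyEq_extend [T2Space M] [IsManifold (𝓡 7) ∞ M]
    [VectorBundle ℝ F V] [ContMDiffVectorBundle ∞ F V (𝓡 7)] {x : M} (v : V x) :
    ∃ σ : (y : M) → V y, SmoothSec F σ ∧ ∀ᶠ y in 𝓝 x, σ y = FiberBundle.extend F v y := by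
  obtain ⟨s, hs, hsv⟩ := FiberBundle.exists_contMDiffOn_extend (k := ∞) (𝓡 7) F v
  obtain ⟨U, hUs, hU, hxU⟩ := mem_nhds_iff.1 hs
  obtain ⟨f, -, hf⟩ := (SmoothBumpFunction.nhds_basis_tsupport (I := 𝓡 7) x).mem_iff.1
    (hU.mem_nhds hxU)
  refine ⟨(f : M → ℝ) • FiberBundle.extend F v, fun y => ?_, ?_⟩
  · by_cases hy : y ∈ tsupport f
    · exact (f.contMDiffAt).smul_section
        (hsv.contMDiffAt (mem_of_superset (hU.mem_nhds (hf hy)) hUs))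
    · have h0 : ContMDiffAt (𝓡 7) ((𝓡 7).prod 𝓘(ℝ, F)) ∞
          (fun z => Bundle.TotalSpace.mk' F z (0 : V z)) y :=
        Bundle.contMDiff_zeroSection ℝ V y
      refine h0.congr_of_eventuallyEq ?_
      filter_upwards [(isClosed_tsupport f).isOpen_compl.mem_nhds hy] with z hz
      have : f z = 0 := image_eq_zero_of_notMem_tsupport hz
      simp [this]
  · filter_upwards [f.eventuallyEq_one] with y hy
    simp [hy]

theorem exists_smoothSec [T2Space M] [IsManifold (𝓡 7) ∞ M] [VectorBundle ℝ F V]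
    [ContMDiffVectorBundle ∞ F V (𝓡 7)] {x : M} (v : V x) :
    ∃ σ : (y : M) → V y, SmoothSec F σ ∧ σ x = v := by
  obtain ⟨σ, hσ, h⟩ := exists_smoothSec_eventuallyEq_extend (F := F) v
  exact ⟨σ, hσ, by rw [h.self_of_nhds, FiberBundle.extend_apply_self]⟩

theorem exists_smoothVF [T2Space M] [IsManifold (𝓡 7) ∞ M] {x : M} (u : TangentSpace (𝓡 7) x) :
    ∃ X : (y : M) → TangentSpace (𝓡 7) y, SmoothVF X ∧ X x = u :=
  exists_smoothSec (F := R7) (V := fun y : M => TangentSpace (𝓡 7) y) u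

lemma SmoothVF.diffVFAt [IsManifold (𝓡 7) ∞ M] {X : (y : M) → TangentSpace (𝓡 7) y} (hX : SmoothVF X) (x : M) :
    DiffVFAt X x :=
  (hX x).mdifferentiableAt (by simp)

section Algebra

variable [VectorBundle ℝ F V]

lemma SmoothSec.add {σ τ : (y : M) → V y} (hσ : SmoothSec F σ) (hτ : SmoothSec F τ) :
    SmoothSec F (fun y => σ y + τ y) := fun y => (hσ y).add_section (hτ y)

lemma SmoothSec.sub {σ τ : (y : M) → V y} (hσ : SmoothSec F σ) (hτ : SmoothSec F τ) :
    SmoothSec F (fun y => σ y - τ y) := fun y => (hσ y).sub_section (hτ y)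

lemma SmoothSec.neg {σ : (y : M) → V y} (hσ : SmoothSec F σ) :
    SmoothSec F (fun y => - σ y) := fun y => (hσ y).neg_section

end Algebra

variable [∀ x, IsTopologicalAddGroup (V x)] [∀ x, ContinuousSMul ℝ (V x)]

/-! ### Curvature as a tensor -/

/-- `∇_X ∇_Y σ - ∇_Y ∇_X σ - ∇_[X, Y] σ`. -/
def curvatureOp (A : CovariantDerivative (𝓡 7) F V) (σ : (y : M) → V y)
    (X Y : (y : M) → TangentSpace (𝓡 7) y) (x : M) : V x :=
  A (fun y => A σ y (Y y)) x (X x) - A (fun y => A σ y (X y)) x (Y x)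
    - A σ x (VectorField.mlieBracket (𝓡 7) X Y x)

variable {A : CovariantDerivative (𝓡 7) F V}

lemma curvatureOp_swap (σ : (y : M) → V y) (X Y : (y : M) → TangentSpace (𝓡 7) y) (x : M) :
    curvatureOp A σ X Y x = - curvatureOp A σ Y X x := by
  rw [curvatureOp, curvatureOp, VectorField.mlieBracket_swap_apply, map_neg]
  abel

variable [IsManifold (𝓡 7) ∞ M] [VectorBundle ℝ F V]

lemma smoothSec_covariantDerivative_hom (hA : ContMDiffCovariantDerivativeOn F ∞ A.toFun Set.univ)
    {σ : (y : M) → V y} (hσ : SmoothSec F σ) :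
    ContMDiff (𝓡 7) ((𝓡 7).prod 𝓘(ℝ, R7 →L[ℝ] F)) ∞
      (fun x => Bundle.TotalSpace.mk' (R7 →L[ℝ] F)
        (E := fun x : M => TangentSpace (𝓡 7) x →L[ℝ] V x) x (A σ x)) := by
  have h : ContMDiffOn (𝓡 7) ((𝓡 7).prod 𝓘(ℝ, F)) (∞ + 1)
      (fun x => Bundle.TotalSpace.mk' F x (σ x)) Set.univ := contMDiffOn_univ.2 hσ
  exact contMDiffOn_univ.1 (hA.contMDiff h)

lemma smoothSec_covariantDerivative (hA : ContMDiffCovariantDerivativeOn F ∞ A.toFun Set.univ)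
    {σ : (y : M) → V y} (hσ : SmoothSec F σ) {X : (y : M) → TangentSpace (𝓡 7) y}
    (hX : SmoothVF X) : SmoothSec F (fun y => A σ y (X y)) :=
  (smoothSec_covariantDerivative_hom hA hσ).clm_bundle_apply hX

lemma mdifferentiableAt_covariantDerivative
    (hA : ContMDiffCovariantDerivativeOn F ∞ A.toFun Set.univ)
    {σ : (y : M) → V y} (hσ : SmoothSec F σ) {X : (y : M) → TangentSpace (𝓡 7) y} {x : M}
    (hX : DiffVFAt X x) :
    MDifferentiableAt (𝓡 7) ((𝓡 7).prod 𝓘(ℝ, F))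
      (fun y => Bundle.TotalSpace.mk' F y (A σ y (X y))) x :=
  ((smoothSec_covariantDerivative_hom hA hσ x).mdifferentiableAt (by simp)).clm_bundle_apply hX

/-- The term in `Y f` from the Leibniz rule for `∇_Y (f ∇_X σ)` cancels the one from `[fX, Y] = f[X,
Y] - (Y f) X`. -/
lemma tensorialAt_curvatureOp_left (hA : ContMDiffCovariantDerivativeOn F ∞ A.toFun Set.univ)
    {σ : (y : M) → V y} (hσ : SmoothSec F σ) (Y : (y : M) → TangentSpace (𝓡 7) y) (x : M) :
    TensorialAt (𝓡 7) R7 (fun X => curvatureOp A σ X Y x) x where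
  smul {f X} hf hX := by
    have h1 : (fun y => A σ y ((f • X) y)) = f • fun y => A σ y (X y) := by
      funext y; simp
    have h2 := mdifferentiableAt_covariantDerivative hA hσ hX
    simp only [curvatureOp, h1]
    rw [A.isCovariantDerivativeOn.leibniz h2 hf,
      VectorField.mlieBracket_smul_left hf hX]
    simp
    module
  add {X X'} hX hX' := by
    have h1 : (fun y => A σ y ((X + X') y)) = (fun y => A σ y (X y)) + fun y => A σ y (X' y) := by
      funext y; simp
    simp only [curvatureOp, h1]
    rw [A.isCovariantDerivativeOn.add (mdifferentiableAt_covariantDerivative hA hσ hX)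
      (mdifferentiableAt_covariantDerivative hA hσ hX'), VectorField.mlieBracket_add_left hX hX']
    simp
    module

lemma tensorialAt_curvatureOp_right (hA : ContMDiffCovariantDerivativeOn F ∞ A.toFun Set.univ)
    {σ : (y : M) → V y} (hσ : SmoothSec F σ) (X : (y : M) → TangentSpace (𝓡 7) y) (x : M) :
    TensorialAt (𝓡 7) R7 (fun Y => curvatureOp A σ X Y x) x where
  smul {f Y} hf hY := by
    have h := (tensorialAt_curvatureOp_left hA hσ X x).smul hf hY
    rw [curvatureOp_swap, h, curvatureOp_swap, smul_neg, neg_neg]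
  add {Y Y'} hY hY' := by
    have h := (tensorialAt_curvatureOp_left hA hσ X x).add hY hY'
    rw [curvatureOp_swap, h, neg_add, ← curvatureOp_swap, ← curvatureOp_swap]

/-- The curvature at `x` of a smooth section, as a tensor. -/
def curvatureHom
    (hA : ContMDiffCovariantDerivativeOn F ∞ A.toFun Set.univ)
    {σ : (y : M) → V y} (hσ : SmoothSec F σ) (x : M) :
    TangentSpace (𝓡 7) x →L[ℝ] TangentSpace (𝓡 7) x →L[ℝ] V x :=
  TensorialAt.mkHom₂ (I := 𝓡 7) (F := R7) (F' := R7) (fun X Y => curvatureOp A σ X Y x) x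
    (fun Y _ => tensorialAt_curvatureOp_left hA hσ Y x)
    (fun X _ => tensorialAt_curvatureOp_right hA hσ X x)

lemma curvatureHom_apply
    (hA : ContMDiffCovariantDerivativeOn F ∞ A.toFun Set.univ)
    {σ : (y : M) → V y} (hσ : SmoothSec F σ) {x : M} {X Y : (y : M) → TangentSpace (𝓡 7) y}
    (hX : DiffVFAt X x) (hY : DiffVFAt Y x) :
    curvatureHom hA hσ x (X x) (Y x) = curvatureOp A σ X Y x :=
  TensorialAt.mkHom₂_apply (I := 𝓡 7) (F := R7) (F' := R7) _ _ hX hY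

lemma curvatureHom_swap
    (hA : ContMDiffCovariantDerivativeOn F ∞ A.toFun Set.univ)
    {σ : (y : M) → V y} (hσ : SmoothSec F σ) {x : M} (u v : TangentSpace (𝓡 7) x) :
    curvatureHom hA hσ x u v = - curvatureHom hA hσ x v u := by
  simp only [curvatureHom, TensorialAt.mkHom₂_apply_eq_extend]
  exact curvatureOp_swap _ _ _ _

end Extension

/-! ### Curvature of Chern connections -/

lemma liftBaseChange_cvec {T W : Type*} [AddCommGroup T] [Module ℝ T] [AddCommGroup W]
    [Module ℂ W] (l : T →ₗ[ℝ] W) (u v : T) :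
    LinearMap.liftBaseChange ℂ l (cvec u v) = l u + Complex.I • l v := by
  simp [cvec]

section Chern

variable {M : Type*} [TopologicalSpace M] [ChartedSpace R7 M] [IsManifold (𝓡 7) ∞ M]
variable {F : Type*} [NormedAddCommGroup F] [NormedSpace ℂ F]
variable {V : M → Type*} [TopologicalSpace (Bundle.TotalSpace F V)]
  [∀ x, AddCommGroup (V x)] [∀ x, Module ℂ (V x)] [∀ x, TopologicalSpace (V x)]
  [∀ x, IsTopologicalAddGroup (V x)] [∀ x, ContinuousSMul ℝ (V x)]
  [FiberBundle F V] [VectorBundle ℝ F V]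
variable {A : CovariantDerivative (𝓡 7) F V}

/-- A covariant derivative depends only on the germ of a section; this is applied once to the
section and once to its first derivatives. -/
lemma curvature_eq_curvatureHom [ContMDiffVectorBundle ∞ F V (𝓡 7)]
    (hA : ContMDiffCovariantDerivativeOn F ∞ A.toFun Set.univ)
    {σ : (y : M) → V y} (hσ : SmoothSec F σ) {x : M} {s : V x}
    (h : ∀ᶠ y in 𝓝 x, σ y = FiberBundle.extend F s y) (u v : TangentSpace (𝓡 7) x) :
    curvature A x u v s = curvatureHom hA hσ x u v := by
  have : IsManifold (𝓡 7) 1 M := IsManifold.of_le (n := ∞) (mod_cast le_top)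
  have hs : ∀ᶠ y in 𝓝 x, MDifferentiableAt (𝓡 7) ((𝓡 7).prod 𝓘(ℝ, F))
      (fun z => Bundle.TotalSpace.mk' F z (FiberBundle.extend F s z)) y := by
    obtain ⟨U, hU, hUs⟩ := FiberBundle.exists_contMDiffOn_extend (k := ∞) (𝓡 7) F s
    filter_upwards [eventually_mem_nhds_iff.2 hU] with y hy
    exact (hUs.contMDiffAt hy).mdifferentiableAt (by simp)
  have e1 : ∀ᶠ y in 𝓝 x, A (FiberBundle.extend F s) y = A σ y := by
    filter_upwards [hs, h.eventually_nhds] with y hy hy'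
    exact A.isCovariantDerivativeOn.congr_of_eventuallyEq hy (hσ.mdifferentiableAt y) univ_mem
      (hy'.mono fun z hz => hz.symm)
  have e2 : ∀ w : TangentSpace (𝓡 7) x,
      A (fun y => A (FiberBundle.extend F s) y (FiberBundle.extend R7 w y)) x =
        A (fun y => A σ y (FiberBundle.extend R7 w y)) x := fun w => by
    have h1 := mdifferentiableAt_covariantDerivative hA hσ
      (FiberBundle.mdifferentiableAt_extend (𝓡 7) R7 w)
    have h2 : ∀ᶠ y in 𝓝 x, A (FiberBundle.extend F s) y (FiberBundle.extend R7 w y) =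
        A σ y (FiberBundle.extend R7 w y) := e1.mono fun y hy => by rw [hy]
    refine A.isCovariantDerivativeOn.congr_of_eventuallyEq
      (h1.congr_of_eventuallyEq ?_) h1 univ_mem h2
    filter_upwards [h2] with y hy
    rw [hy]
  rw [curvatureHom, TensorialAt.mkHom₂_apply_eq_extend, curvature, curvatureOp]
  simp only [e2, e1.self_of_nhds, FiberBundle.extend_apply_self]

variable {S : SasakianStructure M} {Eh : HolomorphicSasakianBundle F V S}
  {H : HermitianStructure Eh}

/-- Apply `[X, Y] f = X Y f - Y X f` to `f = h(σ, τ)` and expand by unitarity: the mixed products of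
first derivatives cancel and only curvature terms remain. -/
lemma curvatureHom_skew [T2Space M] (hA : IsChernConnection H A)
    {σ τ : (y : M) → V y} (hσ : SmoothSec F σ) (hτ : SmoothSec F τ) {x : M}
    (u v : TangentSpace (𝓡 7) x) :
    H.h x (curvatureHom hA.smooth hσ x u v) (τ x) +
      H.h x (σ x) (curvatureHom hA.smooth hτ x u v) = 0 := by
  obtain ⟨X, hX, rfl⟩ := exists_smoothVF u
  obtain ⟨Y, hY, rfl⟩ := exists_smoothVF v
  have hd : ∀ {f : M → ℂ}, ContMDiff (𝓡 7) 𝓘(ℝ, ℂ) ∞ f →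
      MDifferentiableAt (𝓡 7) 𝓘(ℝ, ℂ) f x := fun hf => (hf x).mdifferentiableAt (by simp)
  have hc : ∀ {ρ : (y : M) → V y}, SmoothSec F ρ → ∀ {Z : (y : M) → TangentSpace (𝓡 7) y},
      SmoothVF Z → SmoothSec F (fun y => A ρ y (Z y)) := fun hρ _ hZ =>
    smoothSec_covariantDerivative hA.smooth hρ hZ
  have h1 : ∀ Z : (y : M) → TangentSpace (𝓡 7) y,
      (fun y => mvfderiv (𝓡 7) (fun y => H.h y (σ y) (τ y)) y (Z y)) =
      fun y => H.h y (A σ y (Z y)) (τ y) + H.h y (σ y) (A τ y (Z y)) := fun Z =>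
    funext fun y => hA.unitary σ τ hσ hτ y (Z y)
  have h2 : ∀ Z : (y : M) → TangentSpace (𝓡 7) y, SmoothVF Z →
      ContMDiff (𝓡 7) 𝓘(ℝ, ℂ) ∞
        (fun y => H.h y (A σ y (Z y)) (τ y) + H.h y (σ y) (A τ y (Z y))) := fun Z hZ =>
    (H.smooth _ _ (hc hσ hZ) hτ).add (H.smooth _ _ hσ (hc hτ hZ))
  have h3 : ∀ Z : (y : M) → TangentSpace (𝓡 7) y, SmoothVF Z → ∀ w : TangentSpace (𝓡 7) x,
      mvfderiv (𝓡 7) (fun y => H.h y (A σ y (Z y)) (τ y) + H.h y (σ y) (A τ y (Z y))) x w =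
        H.h x (A (fun y => A σ y (Z y)) x w) (τ x) + H.h x (A σ x (Z x)) (A τ x w) +
        (H.h x (A σ x w) (A τ x (Z x)) + H.h x (σ x) (A (fun y => A τ y (Z y)) x w)) :=
    fun Z hZ w => by
      rw [mvfderiv_fun_add (hd (H.smooth _ _ (hc hσ hZ) hτ)) (hd (H.smooth _ _ hσ (hc hτ hZ))),
        add_apply, hA.unitary _ _ (hc hσ hZ) hτ,
        hA.unitary _ _ hσ (hc hτ hZ)]
  have h4 := mvfderiv_mlieBracket (H.smooth σ τ hσ hτ) (hX.diffVFAt x) (hY.diffVFAt x)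
    (by rw [h1]; exact hd (h2 Y hY)) (by rw [h1]; exact hd (h2 X hX))
  rw [h1, h1, h3 Y hY, h3 X hX, hA.unitary σ τ hσ hτ] at h4
  rw [curvatureHom_apply _ _ (hX.diffVFAt x) (hY.diffVFAt x),
    curvatureHom_apply _ _ (hX.diffVFAt x) (hY.diffVFAt x), curvatureOp, curvatureOp]
  simp only [map_sub, LinearMap.sub_apply]
  linear_combination -h4

/-- Since `A` induces `∂̄` and commutes with `i`, flatness of `∂̄` on `Z = X + iY` and `W = X' +
iY'` is the vanishing of the complexified curvature at `(Z, W)`. -/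
lemma curvatureHom_flat (hA : IsChernConnection H A)
    {σ : (y : M) → V y} (hσ : SmoothSec F σ) {X Y X' Y' : (y : M) → TangentSpace (𝓡 7) y}
    (hX : SmoothVF X) (hY : SmoothVF Y) (hX' : SmoothVF X') (hY' : SmoothVF Y')
    (hZ : ∀ x, cvec (X x) (Y x) ∈ S.B01ext x) (hW : ∀ x, cvec (X' x) (Y' x) ∈ S.B01ext x)
    (hb : ∀ x, cvec
        (VectorField.mlieBracket (𝓡 7) X X' x - VectorField.mlieBracket (𝓡 7) Y Y' x)
        (VectorField.mlieBracket (𝓡 7) X Y' x + VectorField.mlieBracket (𝓡 7) Y X' x) ∈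
          S.B01ext x) (x : M) :
    curvatureHom hA.smooth hσ x (X x) (X' x) - curvatureHom hA.smooth hσ x (Y x) (Y' x)
      + Complex.I • (curvatureHom hA.smooth hσ x (X x) (Y' x)
        + curvatureHom hA.smooth hσ x (Y x) (X' x)) = 0 := by
  have hD : ∀ {ρ : (y : M) → V y}, SmoothSec F ρ → ∀ (y : M) (a b : TangentSpace (𝓡 7) y)
      (h : cvec a b ∈ S.B01ext y), Eh.dbar.toFun ρ y ⟨cvec a b, h⟩ =
        A ρ y a + Complex.I • A ρ y b := fun hρ y a b h => by
    rw [← hA.integrable _ hρ, liftBaseChange_cvec]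
    rfl
  have hAD : ∀ {X Y : (y : M) → TangentSpace (𝓡 7) y}, SmoothVF X → SmoothVF Y →
      ∀ (h : ∀ y, cvec (X y) (Y y) ∈ S.B01ext y) (w : TangentSpace (𝓡 7) x),
      A (fun y => Eh.dbar.toFun σ y ⟨cvec (X y) (Y y), h y⟩) x w =
        A (fun y => A σ y (X y)) x w + Complex.I • A (fun y => A σ y (Y y)) x w :=
    fun {X Y} hX hY h w => by
      have s1 := smoothSec_covariantDerivative hA.smooth hσ hX
      have s2 := smoothSec_covariantDerivative hA.smooth hσ hY
      -- Only the real bundle structure is at hand, so smoothness of the multiple by `i` is read off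
      -- from that of `∂̄σ` by subtraction.
      have s3 : SmoothSec F (fun y => Complex.I • A σ y (Y y)) := by
        have h1 := (Eh.dbar.smooth σ X Y hσ hX hY h).sub s1
        refine (congrArg (SmoothSec F) (funext fun y => ?_)).mp h1
        rw [hD hσ]
        abel
      have h2 : (fun y => Eh.dbar.toFun σ y ⟨cvec (X y) (Y y), h y⟩) =
          (fun y => A σ y (X y)) + fun y => Complex.I • A σ y (Y y) :=
        funext fun y => hD hσ y _ _ _
      rw [h2, A.isCovariantDerivativeOn.add (s1.mdifferentiableAt x) (s3.mdifferentiableAt x),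
        add_apply, hA.complex _ s2]
  have hI : ∀ a : V x, Complex.I • Complex.I • a = -a := fun a => by
    rw [smul_smul, Complex.I_mul_I, neg_one_smul]
  have h := Eh.flat X Y X' Y' hX hY hX' hY' hZ hW hb σ hσ x
  rw [hD (Eh.dbar.smooth σ X' Y' hσ hX' hY' hW), hD (Eh.dbar.smooth σ X Y hσ hX hY hZ), hD hσ,
    hAD hX' hY', hAD hX' hY', hAD hX hY, hAD hX hY] at h
  rw [← h]
  have hc : ∀ {X Y : (y : M) → TangentSpace (𝓡 7) y}, SmoothVF X → SmoothVF Y →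
      curvatureHom hA.smooth hσ x (X x) (Y x) = curvatureOp A σ X Y x := fun hX hY =>
    curvatureHom_apply hA.smooth hσ (hX.diffVFAt x) (hY.diffVFAt x)
  rw [hc hX hX', hc hX hY', hc hY hX', hc hY hY']
  simp only [curvatureOp, map_sub, map_add, smul_sub, smul_add, hI]
  abel

end Chern

/-! ### Pointwise identities of a Sasakian structure -/

section Complexification

variable {T : Type*} [AddCommGroup T] [Module ℝ T]

/-- Real functionals separate points, and the complexification of one takes `u + iv` to a number
with real part `l u` and imaginary part `l v`. -/
lemma cvec_eq_zero {u v : T} (h : cvec u v = 0) : u = 0 ∧ v = 0 := by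
  have key : ∀ l : Module.Dual ℝ T, l u = 0 ∧ l v = 0 := fun l => by
    have h1 := liftBaseChange_cvec (Complex.ofRealCLM.toLinearMap ∘ₗ l) u v
    rw [h, map_zero] at h1
    have h2 := congrArg Complex.re h1
    have h3 := congrArg Complex.im h1
    simp at h2 h3
    exact ⟨h2.symm, h3.symm⟩
  exact ⟨(Module.forall_dual_apply_eq_zero_iff ℝ u).1 fun l => (key l).1,
    (Module.forall_dual_apply_eq_zero_iff ℝ v).1 fun l => (key l).2⟩

end Complexification

namespace SasakianStructure

variable {M : Type*} [TopologicalSpace M] [ChartedSpace R7 M] [IsManifold (𝓡 7) ∞ M]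
variable (S : SasakianStructure M)

section Pointwise

variable (x : M)

/-- The squared length of `Φξ` is `g(ξ, ξ) - θ(ξ)² = 0`. -/
lemma Φ_ξ : S.Φ x (S.ξ x) = 0 := by
  by_contra h
  have h1 := S.g.pos x _ h
  rw [S.g_Φ, S.g_ξ, S.θ_ξ] at h1
  norm_num at h1

lemma θ_eq_inner (u : TangentSpace (𝓡 7) x) : S.θ.app x u = S.g.inner x u (S.ξ x) := by
  have h := S.g_Φ x u (S.ξ x)
  rw [S.Φ_ξ, map_zero, S.θ_ξ, mul_one] at h
  linarith

/-- Compute `Φ³u` as `Φ(Φ²u)` and as `Φ²(Φu)`: the two differ by `θ(Φu) ξ`. -/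
lemma θ_Φ (u : TangentSpace (𝓡 7) x) : S.θ.app x (S.Φ x u) = 0 := by
  have h := S.Φ_sq x (S.Φ x u)
  rw [S.Φ_sq x u, map_add, map_neg, map_smul, S.Φ_ξ, smul_zero, add_zero, left_eq_add] at h
  have h1 := congrArg (fun w => S.g.inner x w (S.ξ x)) h
  simpa [S.g_ξ] using h1

lemma inner_Φ_left (u v : TangentSpace (𝓡 7) x) :
    S.g.inner x (S.Φ x u) v = - S.g.inner x u (S.Φ x v) := by
  have h := S.g_Φ x u (S.Φ x v)
  rw [S.Φ_sq, S.θ_Φ, map_add, map_neg, map_smul, ← S.θ_eq_inner, S.θ_Φ] at h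
  simp only [smul_zero, mul_zero] at h
  linarith

lemma Φ_Φ_of_θ_eq_zero {u : TangentSpace (𝓡 7) x} (hu : S.θ.app x u = 0) :
    S.Φ x (S.Φ x u) = -u := by
  rw [S.Φ_sq, hu, zero_smul, add_zero]

lemma cvec_mem_B01 {u : TangentSpace (𝓡 7) x} (hu : S.θ.app x u = 0) :
    cvec u (S.Φ x u) ∈ S.B01 x := by
  refine ⟨?_, ?_⟩
  · exact add_mem (Submodule.tmul_mem_baseChange_of_mem _ hu)
      (Submodule.tmul_mem_baseChange_of_mem _ (S.θ_Φ x u))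
  · rw [SetLike.mem_coe, LinearMap.mem_ker]
    simp only [cvec, LinearMap.add_apply, map_add, LinearMap.smul_apply, LinearMap.id_apply,
      LinearMap.baseChange_tmul, ContinuousLinearMap.coe_coe, S.Φ_Φ_of_θ_eq_zero x hu,
      TensorProduct.smul_tmul', smul_eq_mul, mul_one, Complex.I_mul_I,
      TensorProduct.tmul_neg, TensorProduct.neg_tmul]
    abel

/-- Every `(0, 1)` vector is `u + iΦu` with `u` horizontal, so conditions on `B^{0,1}` become real
conditions involving `u` and `Φu`. -/
lemma eq_Φ_of_cvec_mem_B01 {u v : TangentSpace (𝓡 7) x} (h : cvec u v ∈ S.B01 x) :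
    S.θ.app x u = 0 ∧ v = S.Φ x u := by
  have h1 := LinearMap.mem_ker.1 h.2
  have h2 : cvec (S.Φ x u - v) (S.Φ x v + u) = 0 := by
    rw [← h1]
    simp only [cvec, LinearMap.add_apply, map_add, LinearMap.smul_apply, LinearMap.id_apply,
      LinearMap.baseChange_tmul, ContinuousLinearMap.coe_coe,
      TensorProduct.smul_tmul', smul_eq_mul, mul_one, Complex.I_mul_I,
      TensorProduct.tmul_sub, TensorProduct.tmul_add, TensorProduct.neg_tmul]
    abel
  obtain ⟨h3, h4⟩ := cvec_eq_zero h2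
  refine ⟨?_, (sub_eq_zero.1 h3).symm⟩
  rw [eq_neg_of_add_eq_zero_right h4, S.θ_eq_inner, map_neg, neg_apply,
    ← S.θ_eq_inner, S.θ_Φ, neg_zero]

/-- Membership only has to be tested modulo `ξ`: the part along `ξ`, with coefficient `θ(p) + ic`,
is absorbed by `ξ_ℂ`. -/
lemma cvec_mem_B01ext {p q : TangentSpace (𝓡 7) x} {c : ℝ} (h : q = S.Φ x p + c • S.ξ x) :
    cvec p q ∈ S.B01ext x := by
  have h0 : S.θ.app x (p - S.θ.app x p • S.ξ x) = 0 := by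
    rw [S.θ_eq_inner, map_sub, map_smul, sub_apply,
      smul_apply, S.g_ξ, ← S.θ_eq_inner]
    simp
  have h1 : cvec p q = cvec (p - S.θ.app x p • S.ξ x) (S.Φ x (p - S.θ.app x p • S.ξ x)) +
      ((S.θ.app x p : ℂ) + Complex.I * c) • ((1 : ℂ) ⊗ₜ[ℝ] S.ξ x) := by
    have h2 : ∀ (z : ℂ) (r : ℝ), z ⊗ₜ[ℝ] (r • S.ξ x) = (z * r) ⊗ₜ[ℝ] S.ξ x := fun z r => by
      rw [← TensorProduct.smul_tmul, mul_comm]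
      rfl
    rw [map_sub, map_smul, S.Φ_ξ, smul_zero, sub_zero, h]
    simp only [cvec, TensorProduct.tmul_add, TensorProduct.tmul_sub, h2, TensorProduct.smul_tmul',
      smul_eq_mul, mul_one, one_mul, TensorProduct.add_tmul]
    abel
  rw [h1]
  exact Submodule.add_mem_sup (S.cvec_mem_B01 x h0)
    (Submodule.smul_mem _ _ (Submodule.mem_span_singleton_self _))

end Pointwise

lemma SmoothVF_Φ {X : (y : M) → TangentSpace (𝓡 7) y} (hX : SmoothVF X) :
    SmoothVF fun y => S.Φ y (X y) :=
  S.Φ_smooth.clm_bundle_apply hX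

/-- The transverse Kähler form in terms of the metric and `Φ`. -/
theorem om_apply (x : M) (u v : TangentSpace (𝓡 7) x) :
    S.om x ![u, v] = -2 * S.κ * S.g.inner x (S.Φ x u) v := by
  obtain ⟨D, hD, hξ, -⟩ := S.levi_civita
  have hd : ∀ w : TangentSpace (𝓡 7) x, DiffVFAt (FiberBundle.extend R7 w) x := fun w =>
    FiberBundle.mdifferentiableAt_extend (𝓡 7) R7 w
  have h1 : ∀ w a : TangentSpace (𝓡 7) x,
      mvfderiv (𝓡 7) (fun y => S.θ.app y (FiberBundle.extend R7 w y)) x a =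
        S.g.inner x (D (FiberBundle.extend R7 w) x a) (S.ξ x) -
          S.κ * S.g.inner x w (S.Φ x a) := fun w a => by
    simp only [S.θ_eq_inner]
    rw [hD.metric _ _ x a (hd w) (S.ξ_smooth.diffVFAt x), hξ, FiberBundle.extend_apply_self,
      map_neg, map_smul, smul_eq_mul, sub_eq_add_neg]
  have h2 := hD.torsion_free _ _ x (hd u) (hd v)
  rw [mlieBracket_extend, FiberBundle.extend_apply_self, FiberBundle.extend_apply_self,
    sub_eq_zero] at h2
  -- The bracket of the extensions vanishes, so the two covariant derivatives agree and their terms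
  -- cancel; the remaining two `κ` terms coincide by skewness of `Φ`, whence the factor 2.
  rw [om, Form.d_apply_extend S.θ_smooth, h1, h1, h2, S.g.symm x v, S.inner_Φ_left x u v]
  ring

end SasakianStructure

/-! ### Involutivity of the extended anti-holomorphic distribution -/

namespace SasakianStructure

variable {M : Type*} [TopologicalSpace M] [ChartedSpace R7 M] [IsManifold (𝓡 7) ∞ M]
variable (S : SasakianStructure M)

lemma exists_horizontalVF [T2Space M] {x : M} {u : TangentSpace (𝓡 7) x}
    (hu : S.θ.app x u = 0) :
    ∃ X : (y : M) → TangentSpace (𝓡 7) y, SmoothVF X ∧ (∀ y, S.θ.app y (X y) = 0) ∧ X x = u := by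
  obtain ⟨U, hU, rfl⟩ := exists_smoothVF u
  -- `-Φ²` is the orthogonal projection onto `ker θ`.
  refine ⟨fun y => S.Φ y (S.Φ y (-U y)), S.SmoothVF_Φ (S.SmoothVF_Φ ?_), fun y => S.θ_Φ y _, ?_⟩
  · exact SmoothSec.neg (F := R7) (V := fun y : M => TangentSpace (𝓡 7) y) hU
  · simp only [map_neg]
    rw [S.Φ_Φ_of_θ_eq_zero x hu, neg_neg]

/-- Write brackets through `∇`. For horizontal `Z`, `∇(ΦZ) = Φ∇Z` modulo `ξ`, so modulo `ξ` the
imaginary part of the bracket is `Φ` of its real part. -/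
theorem cvec_mlieBracket_mem {X X' : (y : M) → TangentSpace (𝓡 7) y}
    (hX : SmoothVF X) (hX' : SmoothVF X') (hθ : ∀ y, S.θ.app y (X y) = 0)
    (hθ' : ∀ y, S.θ.app y (X' y) = 0) (x : M) :
    cvec (VectorField.mlieBracket (𝓡 7) X X' x
        - VectorField.mlieBracket (𝓡 7) (fun y => S.Φ y (X y)) (fun y => S.Φ y (X' y)) x)
      (VectorField.mlieBracket (𝓡 7) X (fun y => S.Φ y (X' y)) x
        + VectorField.mlieBracket (𝓡 7) (fun y => S.Φ y (X y)) X' x) ∈ S.B01ext x := by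
  obtain ⟨D, hD, -, hΦ⟩ := S.levi_civita
  have hY := S.SmoothVF_Φ hX
  have hY' := S.SmoothVF_Φ hX'
  have key : ∀ Z : (y : M) → TangentSpace (𝓡 7) y, SmoothVF Z → (∀ y, S.θ.app y (Z y) = 0) →
      ∀ u : TangentSpace (𝓡 7) x, D (fun y => S.Φ y (Z y)) x u =
        S.Φ x (D Z x u) + (S.κ * S.g.inner x u (Z x)) • S.ξ x := fun Z hZ hZθ u => by
    have h := hΦ Z x u (hZ.diffVFAt x)
    rw [hZθ, zero_smul, sub_zero, smul_smul] at h
    rw [← h]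
    abel
  rw [← hD.torsion_free _ _ x (hX.diffVFAt x) (hX'.diffVFAt x),
    ← hD.torsion_free _ _ x (hY.diffVFAt x) (hY'.diffVFAt x),
    ← hD.torsion_free _ _ x (hX.diffVFAt x) (hY'.diffVFAt x),
    ← hD.torsion_free _ _ x (hY.diffVFAt x) (hX'.diffVFAt x),
    key X hX hθ, key X hX hθ, key X' hX' hθ', key X' hX' hθ']
  -- The `κ` terms come from `∇Φ`, the `θ` terms from `Φ² = -Id + θ ⊗ ξ`.
  refine S.cvec_mem_B01ext x (c :=
    S.κ * S.g.inner x (X x) (X' x) - S.κ * S.g.inner x (X' x) (X x) +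
    (S.θ.app x (D X' x (S.Φ x (X x))) - S.θ.app x (D X x (S.Φ x (X' x))))) ?_
  simp only [map_sub, map_add, map_smul, S.Φ_sq, S.Φ_ξ]
  module

theorem cvec_mlieBracket_reeb_mem {X : (y : M) → TangentSpace (𝓡 7) y}
    (hX : SmoothVF X) (hθ : ∀ y, S.θ.app y (X y) = 0) (x : M) :
    cvec (VectorField.mlieBracket (𝓡 7) X S.ξ x
        - VectorField.mlieBracket (𝓡 7) (fun y => S.Φ y (X y)) 0 x)
      (VectorField.mlieBracket (𝓡 7) X 0 x
        + VectorField.mlieBracket (𝓡 7) (fun y => S.Φ y (X y)) S.ξ x) ∈ S.B01ext x := by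
  obtain ⟨D, hD, hξ, hΦ⟩ := S.levi_civita
  have hY := S.SmoothVF_Φ hX
  have h := hΦ X x (S.ξ x) (hX.diffVFAt x)
  rw [hθ, zero_smul, sub_zero, smul_smul, sub_eq_iff_eq_add] at h
  rw [VectorField.mlieBracket_zero_right, VectorField.mlieBracket_zero_right,
    ← hD.torsion_free _ _ x (hX.diffVFAt x) (S.ξ_smooth.diffVFAt x),
    ← hD.torsion_free _ _ x (hY.diffVFAt x) (S.ξ_smooth.diffVFAt x), hξ, hξ, h]
  refine S.cvec_mem_B01ext x (c := - (S.κ * S.g.inner x (S.ξ x) (X x))) ?_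
  simp only [Pi.zero_apply, sub_zero, zero_add, map_sub, map_neg, map_smul]
  module

end SasakianStructure

/-! ### The type of the curvature of a Chern connection -/

/-- A pair of skew-Hermitian operators `a`, `b` with `a + i b = 0` vanishes. -/
lemma eq_zero_of_skew {W : Type*} [AddCommGroup W] [Module ℂ W] (h : W →ₗ⋆[ℂ] W →ₗ[ℂ] ℂ)
    (hpos : ∀ s, s ≠ 0 → 0 < (h s s).re) {a b : W → W}
    (ha : ∀ s t, h (a s) t + h s (a t) = 0) (hb : ∀ s t, h (b s) t + h s (b t) = 0)
    (hab : ∀ s, a s + Complex.I • b s = 0) (s : W) : a s = 0 := by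
  -- The adjoint of `a + ib` is `-a + ib`; half the difference of the two vanishing operators is
  -- `a`.
  have key : ∀ t, h (a s) t = 0 := fun t => by
    have h1 : h (a s + Complex.I • b s) t = 0 := by rw [hab, map_zero]; rfl
    have h2 : h s (a t + Complex.I • b t) = 0 := by rw [hab, map_zero]
    rw [map_add, LinearMap.add_apply, LinearMap.map_smulₛₗ, LinearMap.smul_apply, Complex.conj_I,
      smul_eq_mul] at h1
    rw [map_add, map_smul, smul_eq_mul] at h2
    linear_combination (1 / 2) * h1 - (1 / 2) * h2 + (1 / 2) * ha s t + Complex.I / 2 * hb s t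
  by_contra hs
  have := hpos _ hs
  rw [key] at this
  simp at this

section Chern

variable {M : Type*} [TopologicalSpace M] [T2Space M] [ChartedSpace R7 M]
  [IsManifold (𝓡 7) ∞ M]
variable {F : Type*} [NormedAddCommGroup F] [NormedSpace ℂ F]
variable {V : M → Type*} [TopologicalSpace (Bundle.TotalSpace F V)]
  [∀ x, AddCommGroup (V x)] [∀ x, Module ℂ (V x)] [∀ x, TopologicalSpace (V x)]
  [∀ x, IsTopologicalAddGroup (V x)] [∀ x, ContinuousSMul ℝ (V x)]
  [FiberBundle F V] [VectorBundle ℝ F V]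
variable {A : CovariantDerivative (𝓡 7) F V}
variable {S : SasakianStructure M} {Eh : HolomorphicSasakianBundle F V S}
  {H : HermitianStructure Eh}

lemma curvatureHom_type_02 (hA : IsChernConnection H A) {σ : (y : M) → V y} (hσ : SmoothSec F σ)
    {x : M} {u v : TangentSpace (𝓡 7) x} (hu : S.θ.app x u = 0) (hv : S.θ.app x v = 0) :
    curvatureHom hA.smooth hσ x u v - curvatureHom hA.smooth hσ x (S.Φ x u) (S.Φ x v)
      + Complex.I • (curvatureHom hA.smooth hσ x u (S.Φ x v)
        + curvatureHom hA.smooth hσ x (S.Φ x u) v) = 0 := by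
  obtain ⟨X, hX, hθ, rfl⟩ := S.exists_horizontalVF hu
  obtain ⟨X', hX', hθ', rfl⟩ := S.exists_horizontalVF hv
  exact curvatureHom_flat hA hσ hX (S.SmoothVF_Φ hX) hX' (S.SmoothVF_Φ hX')
    (fun y => Submodule.mem_sup_left (S.cvec_mem_B01 y (hθ y)))
    (fun y => Submodule.mem_sup_left (S.cvec_mem_B01 y (hθ' y)))
    (S.cvec_mlieBracket_mem hX hX' hθ hθ') x

lemma curvatureHom_reeb (hA : IsChernConnection H A) {σ : (y : M) → V y} (hσ : SmoothSec F σ)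
    {x : M} {u : TangentSpace (𝓡 7) x} (hu : S.θ.app x u = 0) :
    curvatureHom hA.smooth hσ x u (S.ξ x)
      + Complex.I • curvatureHom hA.smooth hσ x (S.Φ x u) (S.ξ x) = 0 := by
  obtain ⟨X, hX, hθ, rfl⟩ := S.exists_horizontalVF hu
  have h0 : SmoothVF (0 : (y : M) → TangentSpace (𝓡 7) y) :=
    Bundle.contMDiff_zeroSection ℝ (fun y : M => TangentSpace (𝓡 7) y)
  have h := curvatureHom_flat hA hσ hX (S.SmoothVF_Φ hX) S.ξ_smooth h0
    (fun y => Submodule.mem_sup_left (S.cvec_mem_B01 y (hθ y)))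
    (fun y => S.cvec_mem_B01ext y (c := 0) (by rw [S.Φ_ξ, zero_smul, zero_add]; rfl))
    (S.cvec_mlieBracket_reeb_mem hX hθ) x
  simpa using h

/-- The curvature of a Chern connection is a horizontal form of type `(1, 1)`. -/
theorem exists_curvature_tensor [ContMDiffVectorBundle ∞ F V (𝓡 7)] (hA : IsChernConnection H A)
    (x : M) : ∃ K : V x → TangentSpace (𝓡 7) x →L[ℝ] TangentSpace (𝓡 7) x →L[ℝ] V x,
      (∀ s u v, curvature A x u v s = K s u v) ∧ (∀ s u v, K s u v = - K s v u) ∧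
      (∀ s u, K s (S.ξ x) u = 0) ∧ (∀ s u v, K s (S.Φ x u) (S.Φ x v) = K s u v) := by
  choose σ hσ hσx using fun s : V x => exists_smoothSec_eventuallyEq_extend (F := F) s
  have hσs : ∀ s, σ s x = s := fun s => by
    rw [(hσx s).self_of_nhds, FiberBundle.extend_apply_self]
  have hsk : ∀ (u v : TangentSpace (𝓡 7) x) (s t : V x),
      H.h x (curvatureHom hA.smooth (hσ s) x u v) t +
        H.h x s (curvatureHom hA.smooth (hσ t) x u v) = 0 := fun u v s t => by
    have h := curvatureHom_skew hA (hσ s) (hσ t) u v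
    rwa [hσs, hσs] at h
  have hξ0 : ∀ s {u : TangentSpace (𝓡 7) x}, S.θ.app x u = 0 →
      curvatureHom hA.smooth (hσ s) x u (S.ξ x) = 0 := fun s u hu =>
    eq_zero_of_skew (H.h x) (H.pos x) (hsk u (S.ξ x)) (hsk (S.Φ x u) (S.ξ x))
      (fun s => curvatureHom_reeb hA (hσ s) hu) s
  -- Here `a = F(u, v) - F(Φu, Φv)` and `b = F(u, Φv) + F(Φu, v)`; the relation `a + ib = 0` is the
  -- vanishing of `F` on the `(0, 1)` vectors `u + iΦu` and `v + iΦv`.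
  have h11 : ∀ s {u v : TangentSpace (𝓡 7) x}, S.θ.app x u = 0 → S.θ.app x v = 0 →
      curvatureHom hA.smooth (hσ s) x u v =
        curvatureHom hA.smooth (hσ s) x (S.Φ x u) (S.Φ x v) := fun s u v hu hv =>
    sub_eq_zero.1 <| eq_zero_of_skew (H.h x) (H.pos x)
      (a := fun s => curvatureHom hA.smooth (hσ s) x u v -
        curvatureHom hA.smooth (hσ s) x (S.Φ x u) (S.Φ x v))
      (fun s t => by
        have h1 := hsk u v s t
        have h2 := hsk (S.Φ x u) (S.Φ x v) s t
        simp only [map_sub, LinearMap.sub_apply]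
        linear_combination h1 - h2)
      (fun s t => by
        have h1 := hsk u (S.Φ x v) s t
        have h2 := hsk (S.Φ x u) v s t
        simp only [map_add, LinearMap.add_apply]
        linear_combination h1 + h2)
      (fun s => curvatureHom_type_02 hA (hσ s) hu hv) s
  have hdec : ∀ u : TangentSpace (𝓡 7) x,
      ∃ (w : TangentSpace (𝓡 7) x) (c : ℝ), S.θ.app x w = 0 ∧ u = w + c • S.ξ x := fun u => by
    refine ⟨-S.Φ x (S.Φ x u), S.θ.app x u, ?_, ?_⟩
    · rw [← map_neg, S.θ_Φ]
    · rw [S.Φ_sq]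
      abel
  have hswap : ∀ s u v, curvatureHom hA.smooth (hσ s) x u v =
      -curvatureHom hA.smooth (hσ s) x v u := fun s => curvatureHom_swap _ _
  have hξξ : ∀ s, curvatureHom hA.smooth (hσ s) x (S.ξ x) (S.ξ x) = 0 := fun s => by
    have h1 := congrArg (fun a => (2 : ℝ)⁻¹ • (a + curvatureHom hA.smooth (hσ s) x (S.ξ x) (S.ξ x)))
      (hswap s (S.ξ x) (S.ξ x))
    simp only [neg_add_cancel, smul_zero, ← two_smul ℝ, smul_smul] at h1
    simpa using h1
  have hξ : ∀ s u, curvatureHom hA.smooth (hσ s) x (S.ξ x) u = 0 := fun s u => by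
    obtain ⟨w, c, hw, rfl⟩ := hdec u
    rw [map_add, map_smul, hξξ, smul_zero, add_zero, hswap, hξ0 s hw, neg_zero]
  have hξ' : ∀ s u, curvatureHom hA.smooth (hσ s) x u (S.ξ x) = 0 := fun s u => by
    rw [hswap, hξ, neg_zero]
  refine ⟨fun s => curvatureHom hA.smooth (hσ s) x,
    fun s u v => curvature_eq_curvatureHom hA.smooth (hσ s) (hσx s) u v, hswap, hξ, ?_⟩
  intro s u v
  obtain ⟨w, c, hw, rfl⟩ := hdec u
  obtain ⟨w', c', hw', rfl⟩ := hdec v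
  simp only [map_add, map_smul, add_apply, smul_apply, S.Φ_ξ, smul_zero, add_zero, hξ, hξ']
  exact (h11 s hw hw').symm

end Chern

/-! ### Expanding wedge products -/

section Wedge

variable {T W : Type*} [AddCommGroup T] [Module ℝ T] [AddCommGroup W] [Module ℝ W]

/-- The wedge product of multilinear maps as an alternating map. -/
def wedgeAlternating {k l : ℕ} (α : MultilinearMap ℝ (fun _ : Fin k => T) W)
    (β : MultilinearMap ℝ (fun _ : Fin l => T) ℝ) : T [⋀^Fin (k + l)]→ₗ[ℝ] W :=
  (((k.factorial * l.factorial : ℕ) : ℝ)⁻¹) • MultilinearMap.alternatization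
    (((TensorProduct.lift (LinearMap.lsmul ℝ W).flip).compMultilinearMap
      (α.domCoprod β)).domDomCongr finSumFinEquiv)

lemma wedgeAlternating_apply {k l : ℕ} (α : MultilinearMap ℝ (fun _ : Fin k => T) W)
    (β : MultilinearMap ℝ (fun _ : Fin l => T) ℝ) (v : Fin (k + l) → T) :
    wedgeAlternating α β v = wedge α β v := by
  rw [wedgeAlternating, AlternatingMap.smul_apply, MultilinearMap.alternatization_apply, wedge]
  refine congrArg _ (Finset.sum_congr rfl fun σ _ => ?_)
  simp only [MultilinearMap.domDomCongr_apply, LinearMap.compMultilinearMap_apply,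
    MultilinearMap.domCoprod_apply, TensorProduct.lift.tmul, LinearMap.flip_apply,
    LinearMap.lsmul_apply, finSumFinEquiv_apply_left, finSumFinEquiv_apply_right, mul_smul]
  rw [Units.smul_def, Int.cast_smul_eq_zsmul]

/-- A permutation is the value `p` at `0` together with a permutation `e` of the rest. The inverse
of `p.cycleRange` has sign `(-1)^p` and enumerates the indices other than `p` by `p.succAbove`. -/
lemma sum_perm_fin_succ {n : ℕ} {A : Type*} [AddCommMonoid A] (f : Equiv.Perm (Fin (n + 1)) → A) :
    ∑ σ, f σ = ∑ p : Fin (n + 1), ∑ e : Equiv.Perm (Fin n),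
      f (p.cycleRange.symm * Equiv.Perm.decomposeFin.symm (0, e)) := by
  trans ∑ x : Fin (n + 1) × Equiv.Perm (Fin n),
    f (x.1.cycleRange.symm * Equiv.Perm.decomposeFin.symm (0, x.2))
  swap
  · exact Fintype.sum_prod_type _
  symm
  refine Fintype.sum_bijective _ ?_ _ _ fun _ => rfl
  rw [Fintype.bijective_iff_injective_and_card]
  refine ⟨?_, by simp [Fintype.card_perm, Nat.factorial]⟩
  rintro ⟨p, e⟩ ⟨p', e'⟩ h
  have h0 := congrArg (fun σ : Equiv.Perm (Fin (n + 1)) => σ 0) h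
  simp only [Equiv.Perm.mul_apply, Equiv.Perm.decomposeFin_symm_apply_zero,
    Fin.cycleRange_symm_zero] at h0
  subst h0
  simpa using h

/-- For fixed `p` the sign of `e` occurs twice, once from `σ` and once from reordering the arguments
of `β`, so the `l!` choices of `e` contribute equally. -/
lemma sum_perm_one {l : ℕ} (β : T [⋀^Fin l]→ₗ[ℝ] ℝ) (a : T → W) (v : Fin (l + 1) → T) :
    ∑ σ : Equiv.Perm (Fin (l + 1)),
      (((Equiv.Perm.sign σ : ℤ) : ℝ) * β (fun j => v (σ j.succ))) • a (v (σ 0)) =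
    (l.factorial : ℝ) • ∑ p : Fin (l + 1),
      ((-1) ^ (p : ℕ) * β (fun j => v (p.succAbove j))) • a (v p) := by
  rw [sum_perm_fin_succ, Finset.smul_sum]
  refine Finset.sum_congr rfl fun p _ => ?_
  have h : ∀ e : Equiv.Perm (Fin l), β (fun j => v (p.succAbove (e j))) =
      ((Equiv.Perm.sign e : ℤ) : ℝ) * β (fun j => v (p.succAbove j)) := fun e => by
    have := β.map_perm (fun j => v (p.succAbove j)) e
    rw [Units.smul_def, ← Int.cast_smul_eq_zsmul ℝ] at this
    exact this
  have hs : ∀ e : Equiv.Perm (Fin l),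
      ((Equiv.Perm.sign e : ℤ) : ℝ) * ((Equiv.Perm.sign e : ℤ) : ℝ) = 1 := fun e => by
    rw [← Int.cast_mul, ← Units.val_mul, Int.units_mul_self]
    simp
  simp only [Equiv.Perm.mul_apply, Equiv.Perm.decomposeFin_symm_apply_zero,
    Equiv.Perm.decomposeFin_symm_apply_succ, Equiv.swap_self, Equiv.refl_apply,
    Fin.cycleRange_symm_zero, Fin.cycleRange_symm_succ, h, map_mul, Equiv.Perm.sign_symm,
    Fin.sign_cycleRange, Equiv.Perm.decomposeFin.symm_sign, if_true, one_mul]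
  rw [Finset.sum_congr rfl (g := fun _ => ((-1 : ℝ) ^ (p : ℕ) * β (fun j => v (p.succAbove j))) • a (v p))]
  · rw [Finset.sum_const, Finset.card_univ, Fintype.card_perm, Fintype.card_fin,
      ← Nat.cast_smul_eq_nsmul ℝ]
  · intro e _
    congr 1
    push_cast
    linear_combination ((-1 : ℝ) ^ (p : ℕ) * β (fun j => v (p.succAbove j))) * hs e

lemma sum_perm_two {l : ℕ} (β : T [⋀^Fin l]→ₗ[ℝ] ℝ) (a : T → T → W) (v : Fin (l + 2) → T) :
    ∑ σ : Equiv.Perm (Fin (l + 2)),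
      (((Equiv.Perm.sign σ : ℤ) : ℝ) * β (fun j => v (σ j.succ.succ))) • a (v (σ 0)) (v (σ 1)) =
    (l.factorial : ℝ) • ∑ p : Fin (l + 2), ∑ q : Fin (l + 1),
      ((-1) ^ (p + q : ℕ) * β (fun j => v (p.succAbove (q.succAbove j)))) •
        a (v p) (v (p.succAbove q)) := by
  rw [sum_perm_fin_succ, Finset.smul_sum]
  refine Finset.sum_congr rfl fun p _ => ?_
  have h := sum_perm_one β (a (v p)) (fun j => v (p.succAbove j))
  have h2 := congrArg (fun w => (-1 : ℝ) ^ (p : ℕ) • w) h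
  simp only [Finset.smul_sum, smul_smul] at h2 ⊢
  refine Eq.trans (Finset.sum_congr rfl fun e _ => ?_)
    (h2.trans (Finset.sum_congr rfl fun q _ => ?_))
  · have h1 : (1 : Fin (l + 2)) = Fin.succ 0 := rfl
    simp only [h1, Equiv.Perm.mul_apply, Equiv.Perm.decomposeFin_symm_apply_zero,
      Equiv.Perm.decomposeFin_symm_apply_succ, Equiv.swap_self, Equiv.refl_apply,
      Fin.cycleRange_symm_zero, Fin.cycleRange_symm_succ, map_mul, Equiv.Perm.sign_symm,
      Fin.sign_cycleRange, Equiv.Perm.decomposeFin.symm_sign, if_true, one_mul]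
    congr 1
    push_cast
    ring
  · congr 1
    ring

lemma wedge_one_three (α : (Fin 1 → T) → W) (β : T [⋀^Fin 3]→ₗ[ℝ] ℝ) (v : Fin 4 → T) :
    wedge (k := 1) (l := 3) α β v =
      ∑ p : Fin 4, ((-1) ^ (p : ℕ) * β (fun j => v (p.succAbove j))) • α ![v p] := by
  have h := sum_perm_one β (fun x => α ![x]) v
  rw [wedge]
  have h1 : ∀ σ : Equiv.Perm (Fin (1 + 3)), (fun i => v (σ (Fin.castAdd 3 i))) = ![v (σ 0)] :=
    fun σ => by ext i; fin_cases i; rfl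
  have h2 : ∀ j : Fin 3, Fin.natAdd 1 j = j.succ := fun j => by ext; simp; omega
  simp only [h1, h2]
  refine (congrArg _ h).trans ?_
  rw [smul_smul]
  norm_num [Nat.factorial]

lemma wedge_two_two (α : (Fin 2 → T) → W) (β : T [⋀^Fin 2]→ₗ[ℝ] ℝ) (v : Fin 4 → T) :
    wedge (k := 2) (l := 2) α β v =
      (2 : ℝ)⁻¹ • ∑ p : Fin 4, ∑ q : Fin 3,
      ((-1) ^ (p + q : ℕ) * β (fun j => v (p.succAbove (q.succAbove j)))) •
        α ![v p, v (p.succAbove q)] := by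
  have h := sum_perm_two β (fun x y => α ![x, y]) v
  rw [wedge]
  have h1 : ∀ σ : Equiv.Perm (Fin (2 + 2)), (fun i => v (σ (Fin.castAdd 2 i))) =
      ![v (σ 0), v (σ 1)] :=
    fun σ => by ext i; fin_cases i <;> rfl
  have h2 : ∀ j : Fin 2, Fin.natAdd 2 j = j.succ.succ := fun j => by ext; simp
  simp only [h1, h2]
  refine (congrArg _ h).trans ?_
  rw [smul_smul]
  norm_num [Nat.factorial]

/-- The sum is over ordered pairs of distinct indices, each unordered pair occurring twice; the `2!`
of the definition remains as `½` after `4!` cancels. -/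
lemma wedge_two_four (α : (Fin 2 → T) → W) (β : T [⋀^Fin 4]→ₗ[ℝ] ℝ) (v : Fin 6 → T) :
    wedge (k := 2) (l := 4) α β v =
      (2 : ℝ)⁻¹ • ∑ p : Fin 6, ∑ q : Fin 5,
      ((-1) ^ (p + q : ℕ) * β (fun j => v (p.succAbove (q.succAbove j)))) •
        α ![v p, v (p.succAbove q)] := by
  have h := sum_perm_two β (fun x y => α ![x, y]) v
  rw [wedge]
  have h1 : ∀ σ : Equiv.Perm (Fin (2 + 4)), (fun i => v (σ (Fin.castAdd 4 i))) =
      ![v (σ 0), v (σ 1)] :=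
    fun σ => by ext i; fin_cases i <;> rfl
  have h2 : ∀ j : Fin 4, Fin.natAdd 2 j = j.succ.succ := fun j => by ext; simp; omega
  simp only [h1, h2]
  refine (congrArg _ h).trans ?_
  rw [smul_smul]
  norm_num [Nat.factorial]

lemma vec_eta_two {A : Type*} (w : Fin 2 → A) : w = ![w 0, w 1] := by
  ext i; fin_cases i <;> rfl

lemma vec_eta_three {A : Type*} (w : Fin 3 → A) : w = ![w 0, w 1, w 2] := by
  ext i; fin_cases i <;> rfl

lemma vec_eta_four {A : Type*} (w : Fin 4 → A) : w = ![w 0, w 1, w 2, w 3] := by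
  ext i; fin_cases i <;> rfl

lemma wedge_one_three_apply (α : (Fin 1 → T) → W) (β : T [⋀^Fin 3]→ₗ[ℝ] ℝ) (a b c d : T) :
    wedge (k := 1) (l := 3) α β ![a, b, c, d] =
      β ![b, c, d] • α ![a] - β ![a, c, d] • α ![b] + β ![a, b, d] • α ![c]
        - β ![a, b, c] • α ![d] := by
  rw [wedge_one_three]
  simp only [Fin.sum_univ_succ, vec_eta_three fun j => ![a, b, c, d] (Fin.succAbove _ j)]
  simp [Fin.succAbove, Fin.lt_def]
  module

lemma alternating_swap (K : T [⋀^Fin 2]→ₗ[ℝ] W) (u v : T) : K ![v, u] = - K ![u, v] := by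
  have h := K.map_swap ![u, v] (i := 0) (j := 1) (by decide)
  rw [← h]
  congr 1
  ext i; fin_cases i <;> rfl

lemma wedge_self_apply (α : T [⋀^Fin 2]→ₗ[ℝ] ℝ) (a b c d : T) :
    wedge (k := 2) (l := 2) α α ![a, b, c, d] =
      2 * (α ![a, b] * α ![c, d] - α ![a, c] * α ![b, d] + α ![a, d] * α ![b, c]) := by
  rw [wedge_two_two]
  simp only [Fin.sum_univ_succ,
    vec_eta_two fun j => ![a, b, c, d] (Fin.succAbove _ (Fin.succAbove _ j))]
  simp [Fin.succAbove, Fin.lt_def]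
  rw [alternating_swap α a b, alternating_swap α a c, alternating_swap α a d,
    alternating_swap α b c, alternating_swap α b d, alternating_swap α c d]
  ring

lemma wedge_two_four_apply (K : T [⋀^Fin 2]→ₗ[ℝ] W) (β : T [⋀^Fin 4]→ₗ[ℝ] ℝ)
    (a b c d e f : T) :
    wedge (k := 2) (l := 4) K β ![a, b, c, d, e, f] =
      β ![c, d, e, f] • K ![a, b] - β ![b, d, e, f] • K ![a, c] + β ![b, c, e, f] • K ![a, d]
      - β ![b, c, d, f] • K ![a, e] + β ![b, c, d, e] • K ![a, f] + β ![a, d, e, f] • K ![b, c]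
      - β ![a, c, e, f] • K ![b, d] + β ![a, c, d, f] • K ![b, e] - β ![a, c, d, e] • K ![b, f]
      + β ![a, b, e, f] • K ![c, d] - β ![a, b, d, f] • K ![c, e] + β ![a, b, d, e] • K ![c, f]
      + β ![a, b, c, f] • K ![d, e] - β ![a, b, c, e] • K ![d, f]
      + β ![a, b, c, d] • K ![e, f] := by
  rw [wedge_two_four]
  simp only [Fin.sum_univ_succ,
    vec_eta_four fun j => ![a, b, c, d, e, f] (Fin.succAbove _ (Fin.succAbove _ j))]
  simp [Fin.succAbove, Fin.lt_def]
  rw [alternating_swap K a b, alternating_swap K a c, alternating_swap K a d,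
    alternating_swap K a e, alternating_swap K a f, alternating_swap K b c,
    alternating_swap K b d, alternating_swap K b e, alternating_swap K b f,
    alternating_swap K c d, alternating_swap K c e, alternating_swap K c f,
    alternating_swap K d e, alternating_swap K d f, alternating_swap K e f]
  module

/-- An alternating `n`-form on an `(n + 1)`-dimensional space is determined by its values on
the `n`-element subfamilies of a basis. -/
lemma alternating_eq_zero_of_basis {n : ℕ} (Γ : T [⋀^Fin n]→ₗ[ℝ] W)
    (b : Module.Basis (Fin (n + 1)) ℝ T)
    (h : ∀ p : Fin (n + 1), Γ (fun i => b (p.succAbove i)) = 0) :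
    Γ = 0 := by
  refine Module.Basis.ext_alternating b fun v hv => ?_
  -- An injective choice of `n` out of `n + 1` indices omits some `p`, hence is a rearrangement of
  -- `p.succAbove`.
  obtain ⟨p, hp⟩ : ∃ p, ∀ i, v i ≠ p := by
    by_contra! hc
    have := Fintype.card_le_of_surjective v hc
    simp at this
  choose τ hτ using fun i => Fin.exists_succAbove_eq (hp i)
  have hinj : Function.Injective τ := fun i j hij => hv (by rw [← hτ, ← hτ, hij])
  have h1 := Γ.map_perm (fun i => b (p.succAbove i))
    (Equiv.ofBijective τ (Finite.injective_iff_bijective.1 hinj))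
  rw [h, smul_zero] at h1
  refine Eq.trans (congrArg Γ (funext fun i => ?_)) h1
  simp [hτ]

end Wedge

/-! ### Hermitian linear algebra in dimension seven -/

section Frames

variable {T W : Type*} [AddCommGroup T] [Module ℝ T] [AddCommGroup W] [Module ℝ W]

/-- Orthonormal families for a bilinear form. -/
def IsOrthonormal (g : T →ₗ[ℝ] T →ₗ[ℝ] ℝ) {n : ℕ} (e : Fin n → T) : Prop :=
  ∀ i j, g (e i) (e j) = if i = j then 1 else 0

variable {g : T →ₗ[ℝ] T →ₗ[ℝ] ℝ}

lemma IsOrthonormal.linearIndependent {n : ℕ} {e : Fin n → T} (he : IsOrthonormal g e) :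
    LinearIndependent ℝ e := by
  rw [Fintype.linearIndependent_iff]
  intro c hc i
  have h := congrArg (fun u => g u (e i)) hc
  simpa [he _ _] using h

/-- An orthonormal family of the right size as a basis. -/
def IsOrthonormal.basis {n : ℕ} [NeZero n] {e : Fin n → T} (he : IsOrthonormal g e)
    (hT : Module.finrank ℝ T = n) : Module.Basis (Fin n) ℝ T :=
  basisOfLinearIndependentOfCardEqFinrank he.linearIndependent (by simp [hT])

lemma IsOrthonormal.basis_apply {n : ℕ} [NeZero n] {e : Fin n → T} (he : IsOrthonormal g e)
    (hT : Module.finrank ℝ T = n) (i : Fin n) : he.basis hT i = e i := by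
  simp [IsOrthonormal.basis]

lemma IsOrthonormal.sum_inner_smul {n : ℕ} [NeZero n] {e : Fin n → T} (he : IsOrthonormal g e)
    (hT : Module.finrank ℝ T = n) (u : T) : ∑ i, g u (e i) • e i = u := by
  have h := (he.basis hT).sum_repr u
  simp only [he.basis_apply] at h
  have h1 : ∀ j, g u (e j) = (he.basis hT).repr u j := fun j => by
    conv_lhs => rw [← h]
    simp [he _ _]
  simp only [h1, h]

/-- The trace with respect to `g` does not depend on the orthonormal basis. This passes from the
arbitrary frames in the Hermitian Yang-Mills condition to an adapted one. -/
lemma IsOrthonormal.sum_diagonal_eq {n : ℕ} [NeZero n] {e f : Fin n → T} (he : IsOrthonormal g e)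
    (hf : IsOrthonormal g f) (hg : ∀ u v, g u v = g v u) (hT : Module.finrank ℝ T = n)
    (K : T →ₗ[ℝ] T →ₗ[ℝ] W) : ∑ i, K (e i) (e i) = ∑ j, K (f j) (f j) := by
  have h1 : ∀ i, K (e i) (e i) = ∑ j, ∑ k, (g (e i) (f j) * g (e i) (f k)) • K (f j) (f k) :=
    fun i => by
      conv_lhs => rw [← hf.sum_inner_smul hT (e i)]
      simp [Finset.smul_sum, smul_smul]
      rw [Finset.sum_comm]
      exact Finset.sum_congr rfl fun j _ => Finset.sum_congr rfl fun k _ => by rw [mul_comm]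
  have h2 : ∀ j k, ∑ i, g (e i) (f j) * g (e i) (f k) = if j = k then 1 else 0 := fun j k => by
    rw [← hf j k]
    conv_rhs => rw [← he.sum_inner_smul hT (f j)]
    simp [hg]
  simp only [h1]
  rw [Finset.sum_comm]
  refine Finset.sum_congr rfl fun j _ => ?_
  rw [Finset.sum_comm]
  simp [← Finset.sum_smul, h2]

/-- Fewer linear conditions than the dimension have a nonzero common solution, which is then
normalised. -/
lemma exists_unit_orthogonal (hpos : ∀ u, u ≠ 0 → 0 < g u u) {n : ℕ}
    (hT : n < Module.finrank ℝ T) (w : Fin n → T) : ∃ u, g u u = 1 ∧ ∀ i, g (w i) u = 0 := by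
  have : FiniteDimensional ℝ T := FiniteDimensional.of_finrank_pos (by omega)
  obtain ⟨u, hu, hu0⟩ := Submodule.exists_mem_ne_zero_of_ne_bot
    (LinearMap.ker_ne_bot_of_finrank_lt (f := LinearMap.pi fun i => g (w i)) (by simpa using hT))
  have hw : ∀ i, g (w i) u = 0 := fun i => congrFun (LinearMap.mem_ker.1 hu) i
  have h := hpos u hu0
  refine ⟨(Real.sqrt (g u u))⁻¹ • u, ?_, fun i => by rw [map_smul, hw, smul_zero]⟩
  have h2 := Real.mul_self_sqrt h.le
  have h3 := (Real.sqrt_pos.2 h).ne'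
  simp only [map_smul, LinearMap.smul_apply, smul_eq_mul]
  field_simp
  nlinarith

lemma two_smul_sum_Ioi {n : ℕ} (s : Fin n → Fin n → W) (hs : ∀ i j, s i j = s j i)
    (h0 : ∀ i, s i i = 0) :
    (2 : ℝ) • ∑ i, ∑ j ∈ Finset.Ioi i, s i j = ∑ i, ∑ j, s i j := by
  have h1 : ∀ i, ∑ j ∈ Finset.Ioi i, s i j = ∑ j, if i < j then s i j else 0 := fun i => by
    rw [← Finset.sum_filter]
    congr 1
    ext j
    simp
  have h2 : ∑ i, ∑ j, (if i < j then s i j else 0) = ∑ i, ∑ j, if j < i then s i j else 0 := by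
    rw [Finset.sum_comm]
    exact Finset.sum_congr rfl fun i _ => Finset.sum_congr rfl fun j _ => by rw [hs]
  simp only [h1]
  rw [two_smul]
  nth_rewrite 2 [h2]
  rw [← Finset.sum_add_distrib]
  refine Finset.sum_congr rfl fun i _ => ?_
  rw [← Finset.sum_add_distrib]
  refine Finset.sum_congr rfl fun j _ => ?_
  rcases lt_trichotomy i j with h | rfl | h
  · simp [h, h.not_gt]
  · simp [h0]
  · simp [h, h.not_gt]

/-- The linear algebra of a Sasakian tangent space. -/
structure IsSasakianModel (g : T →ₗ[ℝ] T →ₗ[ℝ] ℝ) (Φ : T →ₗ[ℝ] T) (ξ : T) : Prop where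
  finrank : Module.finrank ℝ T = 7
  symm : ∀ u v, g u v = g v u
  pos : ∀ u, u ≠ 0 → 0 < g u u
  unit : g ξ ξ = 1
  map_reeb : Φ ξ = 0
  map_map : ∀ u, Φ (Φ u) = -u + g ξ u • ξ
  skew : ∀ u v, g (Φ u) v = - g u (Φ v)

namespace IsSasakianModel

variable {Φ : T →ₗ[ℝ] T} {ξ : T}

lemma inner_reeb_map (h : IsSasakianModel g Φ ξ) (u : T) : g ξ (Φ u) = 0 := by
  rw [h.symm, h.skew, h.map_reeb, map_zero, neg_zero]

lemma inner_map_self (h : IsSasakianModel g Φ ξ) (u : T) : g u (Φ u) = 0 := by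
  have h1 := h.skew u u
  rw [h.symm] at h1
  linarith

lemma inner_map_map (h : IsSasakianModel g Φ ξ) (u v : T) :
    g (Φ u) (Φ v) = g u v - g ξ u * g ξ v := by
  rw [h.skew, h.map_map, map_add, map_neg, map_smul, h.symm u ξ, smul_eq_mul]
  ring

/-- A Sasakian model has an adapted orthonormal frame `ξ, a, Φ a, b, Φ b, c, Φ c`. -/
theorem exists_frame (h : IsSasakianModel g Φ ξ) :
    ∃ a b c : T, g ξ a = 0 ∧ g ξ b = 0 ∧ g ξ c = 0 ∧ g a a = 1 ∧ g b b = 1 ∧ g c c = 1 ∧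
      g a b = 0 ∧ g a c = 0 ∧ g b c = 0 ∧ g a (Φ b) = 0 ∧ g a (Φ c) = 0 ∧ g b (Φ c) = 0 := by
  have hT := h.finrank
  obtain ⟨a, ha, ha'⟩ := exists_unit_orthogonal h.pos (n := 1) (by omega) ![ξ]
  obtain ⟨b, hb, hb'⟩ := exists_unit_orthogonal h.pos (n := 3) (by omega) ![ξ, a, Φ a]
  obtain ⟨c, hc, hc'⟩ := exists_unit_orthogonal h.pos (n := 5) (by omega) ![ξ, a, Φ a, b, Φ b]
  have e : ∀ u v, g (Φ u) v = 0 → g u (Φ v) = 0 := fun u v huv => by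
    rw [h.skew] at huv
    linarith
  exact ⟨a, b, c, ha' 0, hb' 0, hc' 0, ha, hb, hc, hb' 1, hc' 1, hc' 3, e _ _ (hb' 2),
    e _ _ (hc' 2), e _ _ (hc' 4)⟩

end IsSasakianModel

end Frames

/-! ### The instanton equation in an adapted frame -/

section Instanton

variable {T W : Type*} [AddCommGroup T] [Module ℝ T] [AddCommGroup W] [Module ℝ W]
variable {g : T →ₗ[ℝ] T →ₗ[ℝ] ℝ} {Φ : T →ₗ[ℝ] T} {ξ : T}

/-- Orthonormality of `ξ, a, Φ a, b, Φ b, c, Φ c`. -/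
structure IsAdaptedTriple (g : T →ₗ[ℝ] T →ₗ[ℝ] ℝ) (Φ : T →ₗ[ℝ] T) (ξ a b c : T) : Prop where
  ξa : g ξ a = 0
  ξb : g ξ b = 0
  ξc : g ξ c = 0
  aa : g a a = 1
  bb : g b b = 1
  cc : g c c = 1
  ab : g a b = 0
  ac : g a c = 0
  bc : g b c = 0
  aΦb : g a (Φ b) = 0
  aΦc : g a (Φ c) = 0
  bΦc : g b (Φ c) = 0

namespace IsSasakianModel

lemma isOrthonormal_frame (h : IsSasakianModel g Φ ξ) {a b c : T}
    (hf : IsAdaptedTriple g Φ ξ a b c) : IsOrthonormal g ![ξ, a, Φ a, b, Φ b, c, Φ c] := by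
  obtain ⟨ξa, ξb, ξc, aa, bb, cc, ab, ac, bc, aΦb, aΦc, bΦc⟩ := hf
  have Φab : g (Φ a) b = 0 := by rw [h.skew, aΦb, neg_zero]
  have Φac : g (Φ a) c = 0 := by rw [h.skew, aΦc, neg_zero]
  have Φbc : g (Φ b) c = 0 := by rw [h.skew, bΦc, neg_zero]
  have key : ∀ i j, i ≤ j → g (![ξ, a, Φ a, b, Φ b, c, Φ c] i) (![ξ, a, Φ a, b, Φ b, c, Φ c] j) =
      if i = j then 1 else 0 := by
    intro i j hij
    fin_cases i <;> fin_cases j <;>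
      first
      | exact absurd hij (by decide)
      | simp [h.inner_reeb_map, h.inner_map_self, h.inner_map_map, h.unit, *]
  intro i j
  rcases le_total i j with hij | hij
  · exact key i j hij
  · rw [h.symm, key j i hij]
    simp [eq_comm]

variable {K : T →ₗ[ℝ] T →ₗ[ℝ] W} {om : T [⋀^Fin 2]→ₗ[ℝ] ℝ} {κ : ℝ}

/-- The trace of a horizontal form of type `(1, 1)` against `ω`, in any orthonormal frame. -/
theorem two_smul_contraction (h : IsSasakianModel g Φ ξ) (hK : ∀ u v, K u v = - K v u)
    (hom : ∀ u v, om ![u, v] = κ * g (Φ u) v) {e : Fin 7 → T} (he : IsOrthonormal g e) :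
    (2 : ℝ) • ∑ i, ∑ j ∈ Finset.Ioi i, om ![e i, e j] • K (e i) (e j) =
      κ • ∑ i, K (e i) (Φ (e i)) := by
  rw [two_smul_sum_Ioi, Finset.smul_sum]
  · refine Finset.sum_congr rfl fun i _ => ?_
    -- The coefficients of `Φ(e i)` in the frame are, up to `κ`, the values `ω(e i, e j)`.
    conv_rhs => rw [← he.sum_inner_smul h.finrank (Φ (e i))]
    simp [hom, Finset.smul_sum, mul_smul]
  · intro i j
    rw [hK, alternating_swap om (e j) (e i), smul_neg, neg_smul, neg_neg]
  · intro i
    rw [hom, h.symm, h.inner_map_self, mul_zero, zero_smul]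

/-- Twice the contraction is `κ` times the trace of `K(·, Φ·)`. In the adapted frame `ξ` contributes
nothing and `Φa` contributes as much as `a`, which cancels the factor 2. -/
theorem contraction_eq (h : IsSasakianModel g Φ ξ) (hK : ∀ u v, K u v = - K v u)
    (hKξ : ∀ u, K ξ u = 0) (hKΦ : ∀ u v, K (Φ u) (Φ v) = K u v)
    (hom : ∀ u v, om ![u, v] = κ * g (Φ u) v) {a b c : T} (hf : IsAdaptedTriple g Φ ξ a b c)
    {e : Fin 7 → T} (he : IsOrthonormal g e) :
    ∑ i, ∑ j ∈ Finset.Ioi i, om ![e i, e j] • K (e i) (e j) =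
      κ • (K a (Φ a) + K b (Φ b) + K c (Φ c)) := by
  have h1 := h.two_smul_contraction hK hom he
  have h2 := he.sum_diagonal_eq (h.isOrthonormal_frame hf) h.symm h.finrank (K.compl₂ Φ)
  simp only [LinearMap.compl₂_apply] at h2
  rw [h2] at h1
  have h3 : (2 : ℝ) • ∑ i, ∑ j ∈ Finset.Ioi i, om ![e i, e j] • K (e i) (e j) =
      (2 : ℝ) • κ • (K a (Φ a) + K b (Φ b) + K c (Φ c)) := by
    rw [h1]
    simp [Fin.sum_univ_succ, hKΦ, hKξ]
    module
  exact smul_right_injective W (two_ne_zero (α := ℝ)) h3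

end IsSasakianModel

/-- The alternating form of a skew bilinear map. -/
def skewAlternating (K : T →ₗ[ℝ] T →ₗ[ℝ] W) (hK : ∀ u v, K u v = - K v u) :
    T [⋀^Fin 2]→ₗ[ℝ] W where
  toFun v := K (v 0) (v 1)
  map_update_add' := by
    clear hK
    intro _ m i x y
    fin_cases i <;> simp
  map_update_smul' := by
    clear hK
    intro _ m i x y
    fin_cases i <;> simp
  map_eq_zero_of_eq' := by
    intro v i j hv hij
    have h0 : ∀ u, K u u = 0 := fun u => by
      have h1 : (2 : ℝ) • K u u = 0 := by
        rw [two_smul]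
        nth_rw 1 [hK u u]
        exact neg_add_cancel _
      exact (smul_eq_zero_iff_right (two_ne_zero (α := ℝ))).1 h1
    have h01 : v 0 = v 1 := by
      clear h0 hK
      fin_cases i <;> fin_cases j <;> first | exact hv | exact hv.symm | exact absurd rfl hij
    change K (v 0) (v 1) = 0
    rw [h01, h0]

lemma skewAlternating_apply (K : T →ₗ[ℝ] T →ₗ[ℝ] W) (hK : ∀ u v, K u v = - K v u) (u v : T) :
    skewAlternating K hK ![u, v] = K u v := rfl

lemma alternating_swap_left (ε : T [⋀^Fin 3]→ₗ[ℝ] W) (u v w : T) :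
    ε ![v, u, w] = - ε ![u, v, w] := by
  have h := ε.map_swap ![u, v, w] (i := 0) (j := 1) (by decide)
  rw [← h]
  congr 1
  ext i; fin_cases i <;> rfl

lemma alternating_swap_right (ε : T [⋀^Fin 3]→ₗ[ℝ] W) (u v w : T) :
    ε ![u, w, v] = - ε ![u, v, w] := by
  have h := ε.map_swap ![u, v, w] (i := 1) (j := 2) (by decide)
  rw [← h]
  congr 1
  ext i; fin_cases i <;> rfl

/-- The form `½ ω ∧ ω + θ ∧ Re ε` as an alternating map. -/
def psiAlternating (θ : T [⋀^Fin 1]→ₗ[ℝ] ℝ) (om : T [⋀^Fin 2]→ₗ[ℝ] ℝ) (ε : T [⋀^Fin 3]→ₗ[ℝ] ℂ) :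
    T [⋀^Fin 4]→ₗ[ℝ] ℝ :=
  (1 / 2 : ℝ) • wedgeAlternating (k := 2) (l := 2) om.toMultilinearMap om.toMultilinearMap +
    wedgeAlternating (k := 1) (l := 3) θ.toMultilinearMap
      (Complex.reLm.compAlternatingMap ε).toMultilinearMap

lemma psiAlternating_apply (θ : T [⋀^Fin 1]→ₗ[ℝ] ℝ) (om : T [⋀^Fin 2]→ₗ[ℝ] ℝ)
    (ε : T [⋀^Fin 3]→ₗ[ℝ] ℂ) (v : Fin 4 → T) :
    psiAlternating θ om ε v = 1 / 2 * wedge (k := 2) (l := 2) om om v +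
      wedge (k := 1) (l := 3) θ (fun w => (ε w).re) v := by
  rw [psiAlternating, AlternatingMap.add_apply, AlternatingMap.smul_apply,
    wedgeAlternating_apply, wedgeAlternating_apply]
  rfl

lemma psiAlternating_apply_vec (θ : T [⋀^Fin 1]→ₗ[ℝ] ℝ) (om : T [⋀^Fin 2]→ₗ[ℝ] ℝ)
    (ε : T [⋀^Fin 3]→ₗ[ℝ] ℂ) (a b c d : T) :
    psiAlternating θ om ε ![a, b, c, d] =
      om ![a, b] * om ![c, d] - om ![a, c] * om ![b, d] + om ![a, d] * om ![b, c] +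
      (θ ![a] * (ε ![b, c, d]).re - θ ![b] * (ε ![a, c, d]).re + θ ![c] * (ε ![a, b, d]).re
        - θ ![d] * (ε ![a, b, c]).re) := by
  have h := wedge_one_three_apply θ (Complex.reLm.compAlternatingMap ε) a b c d
  rw [psiAlternating_apply, wedge_self_apply]
  refine (congrArg _ h).trans ?_
  simp only [LinearMap.compAlternatingMap_apply, smul_eq_mul]
  change _ + ((ε ![b, c, d]).re * _ - (ε ![a, c, d]).re * _ + (ε ![a, b, d]).re * _
    - (ε ![a, b, c]).re * _) = _
  ring

section Contraction

variable {K : T →ₗ[ℝ] T →ₗ[ℝ] W} {θ : T [⋀^Fin 1]→ₗ[ℝ] ℝ} {om : T [⋀^Fin 2]→ₗ[ℝ] ℝ}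
  {ε : T [⋀^Fin 3]→ₗ[ℝ] ℂ} {κ : ℝ}

/-- For a horizontal `2`-form `K` of type `(1, 1)`, the contraction `(K, ω)` vanishes if and only if
`K ∧ ψ = 0`. -/
theorem contraction_eq_zero_iff (h : IsSasakianModel g Φ ξ) (hK : ∀ u v, K u v = - K v u)
    (hKξ : ∀ u, K ξ u = 0) (hKΦ : ∀ u v, K (Φ u) (Φ v) = K u v)
    (hθ : ∀ u, θ ![u] = g ξ u) (hκ : κ ≠ 0) (hom : ∀ u v, om ![u, v] = κ * g (Φ u) v)
    (hεΦ : ∀ u v w, ε ![Φ u, v, w] = Complex.I * ε ![u, v, w]) :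
    (∀ e : Fin 7 → T, IsOrthonormal g e →
      ∑ i, ∑ j ∈ Finset.Ioi i, om ![e i, e j] • K (e i) (e j) = 0) ↔
    ∀ v, wedge (k := 2) (l := 4) (skewAlternating K hK) (psiAlternating θ om ε) v = 0 := by
  obtain ⟨a, b, c, hf⟩ := h.exists_frame
  have hf : IsAdaptedTriple g Φ ξ a b c := by
    obtain ⟨h1, h2, h3, h4, h5, h6, h7, h8, h9, h10, h11, h12⟩ := hf
    exact ⟨h1, h2, h3, h4, h5, h6, h7, h8, h9, h10, h11, h12⟩
  have ho := h.isOrthonormal_frame hf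
  have hsum := fun e (he : IsOrthonormal g e) => h.contraction_eq hK hKξ hKΦ hom hf he
  have hε1 : ∀ u w, ε ![u, u, w] = 0 := fun u w =>
    ε.map_eq_zero_of_eq _ (i := 0) (j := 1) rfl (by decide)
  have hε2 : ∀ u w, ε ![w, u, u] = 0 := fun u w =>
    ε.map_eq_zero_of_eq _ (i := 1) (j := 2) rfl (by decide)
  have hεΦ1 : ∀ u v w, ε ![v, Φ u, w] = Complex.I * ε ![v, u, w] := fun u v w => by
    rw [alternating_swap_left, hεΦ, alternating_swap_left ε v u w, mul_neg, neg_neg]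
  have hεΦ2 : ∀ u v w, ε ![v, w, Φ u] = Complex.I * ε ![v, w, u] := fun u v w => by
    rw [alternating_swap_right, hεΦ1, alternating_swap_right ε v w u, mul_neg, neg_neg]
  have hKΦ' : ∀ u v, g ξ v = 0 → K (Φ u) v = - K u (Φ v) := fun u v hv => by
    have h1 := hKΦ u (Φ v)
    rw [h.map_map, hv, zero_smul, add_zero, map_neg] at h1
    rw [← h1, neg_neg]
  obtain ⟨ξa, ξb, ξc, aa, bb, cc, ab, ac, bc, aΦb, aΦc, bΦc⟩ := hf
  have hKb := fun u => hKΦ' u b ξb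
  have hKc := fun u => hKΦ' u c ξc
  have oξ : ∀ u, om ![ξ, u] = 0 := fun u => by simp [hom, h.map_reeb]
  have oaΦ : om ![a, Φ a] = κ := by simp [hom, h.inner_map_map, ξa, aa]
  have obΦ : om ![b, Φ b] = κ := by simp [hom, h.inner_map_map, ξb, bb]
  have ocΦ : om ![c, Φ c] = κ := by simp [hom, h.inner_map_map, ξc, cc]
  have o1 : om ![a, b] = 0 := by simp [hom, h.skew, aΦb]
  have o2 : om ![a, c] = 0 := by simp [hom, h.skew, aΦc]
  have o3 : om ![b, c] = 0 := by simp [hom, h.skew, bΦc]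
  have o4 : om ![a, Φ b] = 0 := by simp [hom, h.inner_map_map, ξa, ab]
  have o5 : om ![a, Φ c] = 0 := by simp [hom, h.inner_map_map, ξa, ac]
  have o6 : om ![b, Φ c] = 0 := by simp [hom, h.inner_map_map, ξb, bc]
  have o7 : om ![Φ a, b] = 0 := by simp [hom, h.map_map, ξa, ab]
  have o8 : om ![Φ a, c] = 0 := by simp [hom, h.map_map, ξa, ac]
  have o9 : om ![Φ b, c] = 0 := by simp [hom, h.map_map, ξb, bc]
  have o10 : om ![Φ a, Φ b] = 0 := by simp [hom, h.map_map, ξa, aΦb]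
  have o11 : om ![Φ a, Φ c] = 0 := by simp [hom, h.map_map, ξa, aΦc]
  have o12 : om ![Φ b, Φ c] = 0 := by simp [hom, h.map_map, ξb, bΦc]
  have tξ : θ ![ξ] = 1 := by rw [hθ, h.unit]
  have ta : θ ![a] = 0 := by rw [hθ, ξa]
  have tb : θ ![b] = 0 := by rw [hθ, ξb]
  have tc : θ ![c] = 0 := by rw [hθ, ξc]
  have tΦ : ∀ u, θ ![Φ u] = 0 := fun u => by rw [hθ, h.inner_reeb_map]
  -- On horizontal vectors `θ ∧ Re ε` drops out, and `ω` pairs each vector only with its image under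
  -- `Φ`: `K(a, Φa)` is multiplied by `ω(b, Φb) ω(c, Φc) = κ²`, and likewise for `b` and `c`.
  have h0 : wedge (k := 2) (l := 4) (skewAlternating K hK) (psiAlternating θ om ε)
      ![a, Φ a, b, Φ b, c, Φ c] = κ • κ • (K a (Φ a) + K b (Φ b) + K c (Φ c)) := by
    rw [wedge_two_four_apply]
    simp only [psiAlternating_apply_vec, skewAlternating_apply, oaΦ, obΦ, ocΦ, o1, o2, o3, o4, o5,
      o6, o7, o8, o9, o10, o11, o12, ta, tb, tc, tΦ, zero_mul, mul_zero, zero_smul, sub_zero,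
      add_zero]
    module
  have hI : ∀ z : ℂ, Complex.I * (Complex.I * z) = -z := fun z => by
    rw [← mul_assoc, Complex.I_mul_I, neg_one_mul]
  -- With `ξ` among the arguments, `K ∧ ω²` vanishes by horizontality. What remains is `K ∧ Re ε` on
  -- five horizontal vectors, zero by type; no assumption on the contraction is involved.
  obtain ⟨hw1, hw2, hw3, hw4, hw5, hw6⟩ :
      wedge (k := 2) (l := 4) (skewAlternating K hK) (psiAlternating θ om ε)
        ![ξ, Φ a, b, Φ b, c, Φ c] = 0 ∧
      wedge (k := 2) (l := 4) (skewAlternating K hK) (psiAlternating θ om ε)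
        ![ξ, a, b, Φ b, c, Φ c] = 0 ∧
      wedge (k := 2) (l := 4) (skewAlternating K hK) (psiAlternating θ om ε)
        ![ξ, a, Φ a, Φ b, c, Φ c] = 0 ∧
      wedge (k := 2) (l := 4) (skewAlternating K hK) (psiAlternating θ om ε)
        ![ξ, a, Φ a, b, c, Φ c] = 0 ∧
      wedge (k := 2) (l := 4) (skewAlternating K hK) (psiAlternating θ om ε)
        ![ξ, a, Φ a, b, Φ b, Φ c] = 0 ∧
      wedge (k := 2) (l := 4) (skewAlternating K hK) (psiAlternating θ om ε)
        ![ξ, a, Φ a, b, Φ b, c] = 0 := by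
    refine ⟨?_, ?_, ?_, ?_, ?_, ?_⟩
    all_goals
      rw [wedge_two_four_apply]
      simp only [psiAlternating_apply_vec, skewAlternating_apply, oaΦ, obΦ, ocΦ, oξ, o1, o2, o3,
        o4, o5, o6, o7, o8, o9, o10, o11, o12, tξ, ta, tb, tc, tΦ, hε1, hε2, hεΦ, hεΦ1,
        hεΦ2, hKξ, hKΦ, hKb, hKc, hI, smul_zero, zero_mul, mul_zero,
        Complex.zero_re, Complex.neg_re, mul_neg]
      module
  constructor
  · intro H
    have hz : K a (Φ a) + K b (Φ b) + K c (Φ c) = 0 :=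
      (smul_eq_zero_iff_right hκ).1 ((hsum _ ho).symm.trans (H _ ho))
    -- A `6`-form in dimension seven is tested on the seven subfamilies omitting one frame vector;
    -- only the one omitting `ξ` sees the contraction.
    have hΓ : wedgeAlternating (k := 2) (l := 4) (skewAlternating K hK).toMultilinearMap
        (psiAlternating θ om ε).toMultilinearMap = 0 := by
      refine alternating_eq_zero_of_basis _ (ho.basis h.finrank) fun p => ?_
      rw [wedgeAlternating_apply]
      simp only [ho.basis_apply]
      have hp : ∀ w : Fin 6 → T, (fun i => ![ξ, a, Φ a, b, Φ b, c, Φ c] (p.succAbove i)) = w →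
          wedge (k := 2) (l := 4) (skewAlternating K hK) (psiAlternating θ om ε) w = 0 →
          wedge (k := 2) (l := 4) (skewAlternating K hK) (psiAlternating θ om ε)
            (fun i => ![ξ, a, Φ a, b, Φ b, c, Φ c] (p.succAbove i)) = 0 := by
        rintro w rfl hw
        exact hw
      fin_cases p
      · exact hp ![a, Φ a, b, Φ b, c, Φ c] (by ext i; fin_cases i <;> rfl) (by rw [h0, hz, smul_zero, smul_zero])
      · exact hp _ (by ext i; fin_cases i <;> rfl) hw1
      · exact hp _ (by ext i; fin_cases i <;> rfl) hw2
      · exact hp _ (by ext i; fin_cases i <;> rfl) hw3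
      · exact hp _ (by ext i; fin_cases i <;> rfl) hw4
      · exact hp _ (by ext i; fin_cases i <;> rfl) hw5
      · exact hp _ (by ext i; fin_cases i <;> rfl) hw6
    intro v
    have := congrArg (fun Γ => Γ v) hΓ
    exact (wedgeAlternating_apply _ _ v).symm.trans this
  · intro H e he
    have h1 := h0.symm.trans (H _)
    rw [hsum e he, (smul_eq_zero_iff_right hκ).1 h1]

end Contraction

end Instanton

/-! ### Tangent spaces as Sasakian models, and the forms `ε` and `ψ` at a point -/

section Main

variable {M : Type*} [TopologicalSpace M] [ChartedSpace R7 M] [IsManifold (𝓡 7) ∞ M]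

namespace SasakianStructure

variable (S : SasakianStructure M)

/-- The metric on a tangent space, as a bilinear map. -/
def metric (x : M) : TangentSpace (𝓡 7) x →ₗ[ℝ] TangentSpace (𝓡 7) x →ₗ[ℝ] ℝ :=
  ContinuousLinearMap.coeLM ℝ ∘ₗ (S.g.inner x).toLinearMap

lemma metric_apply (x : M) (u v : TangentSpace (𝓡 7) x) : S.metric x u v = S.g.inner x u v := rfl

lemma isSasakianModel (x : M) : IsSasakianModel (S.metric x) (S.Φ x).toLinearMap (S.ξ x) where
  finrank := finrank_euclideanSpace_fin (𝕜 := ℝ) (n := 7)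
  symm := S.g.symm x
  pos := S.g.pos x
  unit := S.g_ξ x
  map_reeb := S.Φ_ξ x
  map_map u := by
    have h : S.metric x (S.ξ x) u = S.θ.app x u := by
      rw [metric_apply, S.g.symm, S.θ_eq_inner]
    rw [h]
    exact S.Φ_sq x u
  skew := S.inner_Φ_left x

end SasakianStructure

namespace ContactCalabiYau

variable {S : SasakianStructure M} (C : ContactCalabiYau S)

/-- Apply the type condition to the `(0, 1)` vector `Φu + iΦ²u`. Starting from `Φu`, which is always
horizontal, covers every `u`, and `Φ²u` may be replaced by `-u` because `ξ ⌟ ε = 0`. -/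
lemma ε_Φ (x : M) (u v w : TangentSpace (𝓡 7) x) :
    C.ε x ![S.Φ x u, v, w] = Complex.I * C.ε x ![u, v, w] := by
  have hu : S.θ.app x (S.Φ x u) = 0 := S.θ_Φ x u
  have h := C.type_30 x _ _ v w (S.cvec_mem_B01 x hu)
  have h1 : C.ε x ![S.Φ x (S.Φ x u), v, w] = - C.ε x ![u, v, w] := by
    have h2 : ∀ c : ℝ, C.ε x ![-u + c • S.ξ x, v, w] = -C.ε x ![u, v, w] := fun c => by
      have ha := (C.ε x).toMultilinearMap.cons_add ![v, w] (-u) (c • S.ξ x)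
      have hb := (C.ε x).toMultilinearMap.cons_smul ![v, w] c (S.ξ x)
      have hc := (C.ε x).toMultilinearMap.cons_smul ![v, w] (-1) u
      have hd := C.horizontal x ![v, w]
      rw [neg_one_smul, neg_one_smul] at hc
      refine ha.trans ?_
      rw [hb, hc]
      erw [hd]
      rw [smul_zero, add_zero]
      rfl
    rw [S.Φ_sq, h2]
  rw [h1] at h
  linear_combination h

lemma ψ_eq_psiAlternating (x : M) : C.ψ x = psiAlternating (S.θ x).toAlternatingMap
    (S.om x).toAlternatingMap (C.ε x).toAlternatingMap := by
  ext v
  rw [psiAlternating_apply]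
  rfl

end ContactCalabiYau

end Main

end SasakiGauge

end

/-! ### The equivalence of the two equations -/

open SasakiGauge in
theorem mainTheorem6
    {M : Type*} [TopologicalSpace M] [T2Space M] [CompactSpace M]
    [ChartedSpace R7 M] [IsManifold (𝓡 7) ∞ M]
    (S : SasakianStructure M) (C : ContactCalabiYau S)
    {F : Type*} [NormedAddCommGroup F] [NormedSpace ℂ F] [FiniteDimensional ℂ F]
    {V : M → Type*} [TopologicalSpace (Bundle.TotalSpace F V)]
    [∀ x, AddCommGroup (V x)] [∀ x, Module ℂ (V x)] [∀ x, TopologicalSpace (V x)]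
    [∀ x, IsTopologicalAddGroup (V x)] [∀ x, ContinuousSMul ℝ (V x)]
    [FiberBundle F V] [VectorBundle ℂ F V] [VectorBundle ℝ F V]
    [ContMDiffVectorBundle ∞ F V (𝓡 7)]
    (Eh : HolomorphicSasakianBundle F V S) (H : HermitianStructure Eh)
    (A : CovariantDerivative (𝓡 7) F V) (hA : IsChernConnection H A) :
    IsHYM S A ↔ IsG2Instanton C.ψ A := by
  have key : ∀ (x : M) (s : V x),
      (∀ e : Fin 7 → TangentSpace (𝓡 7) x,
        (∀ i j, S.g.inner x (e i) (e j) = if i = j then 1 else 0) →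
        ∑ i, ∑ j ∈ Finset.Ioi i, S.om x ![e i, e j] • curvature A x (e i) (e j) s = 0) ↔
      ∀ v : Fin 6 → TangentSpace (𝓡 7) x,
        wedge (fun w : Fin 2 → TangentSpace (𝓡 7) x => curvature A x (w 0) (w 1) s) (C.ψ x) v
          = 0 := by
    intro x s
    obtain ⟨K, hKc, hK, hKξ, hKΦ⟩ := exists_curvature_tensor hA x
    have hκ : -2 * S.κ ≠ 0 := by rcases S.κ_eq with h | h <;> norm_num [h]
    -- The constant called `κ` in the linear model is `-2κ` of the Sasakian structure.
    have main := contraction_eq_zero_iff (K := ContinuousLinearMap.coeLM ℝ ∘ₗ (K s).toLinearMap)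
      (θ := (S.θ x).toAlternatingMap) (om := (S.om x).toAlternatingMap)
      (ε := (C.ε x).toAlternatingMap) (S.isSasakianModel x) (hK s) (hKξ s) (hKΦ s)
      (fun u => (S.θ_eq_inner x u).trans (S.g.symm x _ _)) hκ (S.om_apply x)
      (C.ε_Φ x)
    simp only [hKc]
    rw [C.ψ_eq_psiAlternating]
    exact main
  constructor
  · exact fun h x s => (key x s).1 (h.contraction x s)
  · refine fun h => ⟨fun x s => (key x s).2 (h x s), fun x s u v u' v' hu hu' => ?_⟩
    obtain ⟨K, hKc, -, hKξ, hKΦ⟩ := exists_curvature_tensor hA x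
    obtain ⟨-, rfl⟩ := S.eq_Φ_of_cvec_mem_B01 x hu
    obtain ⟨hθ, rfl⟩ := S.eq_Φ_of_cvec_mem_B01 x hu'
    -- The `(0, 2)` component vanishes for any Chern connection: type `(1, 1)` gives `K(u, Φu') =
    -- -K(Φu, u')` and `K(Φu, Φu') = K(u, u')`.
    have h1 := hKΦ s u (S.Φ x u')
    rw [S.Φ_Φ_of_θ_eq_zero x hθ, map_neg] at h1
    rw [hKc, hKc, hKc, hKc, hKΦ, ← h1, sub_self, neg_add_cancel, smul_zero, add_zero]
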